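/- Let $L\ge 1$ and $k\ge 0$ be fixed integers and let $A_0,A_1,\dots,A_k\in\mathbb R^{L\times L}$ be symmetric. For each $N$ let $W_1,\dots,W_k$ be independent $N\times N$ GOE matrices, i.e. symmetric with independent centered real Gaussian entries $(W_j)_{ab}$, $a\le b$, of variance $(1+\mathbf 1_{\{a=b\}})/N$, and put $$X^{(N)}=\sum_{j=1}^k A_j\otimes W_j+A_0\otimes \mathrm{Id}_N .$$ Let $u=(u_1,\dots,u_L)$, with blocks $u_i\in\mathbb R^N$, be uniformly distributed on the unit sphere $\mathbb S^{NL-1}$, independently of the $W_j$, and let $\widetilde Y=\rho(u)=(\langle u_i,u_j\rangle)_{i,j=1}^L$ be the Gram matrix of its blocks (which has trace one). For symmetric $T\in\mathbb R^{L\times L}$ set $\mathcal S(T)=\sum_{j=1}^kA_jTA_j$. For $\theta\in\mathbb R$ and a real symmetric positive semi-definite $L\times L$ matrix $\Psi$ with $\operatorname{Tr}\Psi=1$ put $$K(\theta,\Psi)=L^2\theta^2\operatorname{Tr}[\Psi\,\mathcal S(\Psi)]+L\theta\operatorname{Tr}[A_0\Psi]+\tfrac12\big(\log\det\Psi+L\log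 L\big)\in[-\infty,\infty),$$ with $\log 0=-\infty$. Then for every $\theta\in\mathbb R$ and every such $\Psi$, with $\|\cdot\|$ the operator norm, $$\begin{aligned}K(\theta,\Psi)&=\lim_{\delta\downarrow0}\limsup_{N\to\infty}\frac1N\log\mathbb E_u\mathbb E_W\Big[e^{\theta NL\langle u,X^{(N)}u\rangle}\mathbf 1_{\{\|\widetilde Y-\Psi\|\le\delta\}}\Big]\\&=\lim_{\delta\downarrow0}\liminf_{N\to\infty}\frac1N\log\mathbb E_u\mathbb E_W\Big[e^{\theta NL\langle u,X^{(N)}u\rangle}\mathbf 1_{\{\|\widetilde Y-\Psi\|\le\delta\}}\Big].\end{aligned}$$ -/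

import Mathlib

open MeasureTheory ProbabilityTheory Filter Topology
open scoped ENNReal NNReal Kronecker Matrix

namespace KroneckerLDP

/-- `W 0, …, W (k-1)` are independent `N × N` GOE matrices on the probability space `(Ω, P)`: each
is almost surely symmetric, its entries `(a, b)` with `a ≤ b` are centered real Gaussian variables
with variance `(1 + 1_{a = b}) / N`, and all these upper triangular entries, of all the matrices,
are jointly independent. -/
structure IsIndepGOE {Ω : Type*} [MeasurableSpace Ω] (P : Measure Ω) {N k : ℕ}
    (W : Fin k → Ω → Matrix (Fin N) (Fin N) ℝ) : Prop where
  measurable : ∀ j a b, Measurable fun ω => W j ω a b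
  symm : ∀ j, ∀ᵐ ω ∂P, (W j ω).IsSymm
  law : ∀ j a b, a ≤ b →
    HasLaw (fun ω => W j ω a b) (gaussianReal 0 ((1 + if a = b then 1 else 0) / (N : ℝ≥0))) P
  indep : iIndepFun
    (fun (p : Fin k × {q : Fin N × Fin N // q.1 ≤ q.2}) (ω : Ω) =>
      W p.1 ω p.2.1.1 p.2.1.2) P

/-- The Kronecker matrix `∑ j, A j ⊗ W j + A₀ ⊗ Id`. -/
noncomputable def kronModel {L N k : ℕ} (A₀ : Matrix (Fin L) (Fin L) ℝ)
    (A : Fin k → Matrix (Fin L) (Fin L) ℝ) (W : Fin k → Matrix (Fin N) (Fin N) ℝ) :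
    Matrix (Fin L × Fin N) (Fin L × Fin N) ℝ :=
  ∑ j, A j ⊗ₖ W j + A₀ ⊗ₖ (1 : Matrix (Fin N) (Fin N) ℝ)

/-- The `i`-th block `u_i ∈ ℝ^N` of `u = (u_1, …, u_L) ∈ ℝ^{NL}`. -/
noncomputable def block {L N : ℕ} (u : EuclideanSpace ℝ (Fin L × Fin N)) (i : Fin L) :
    EuclideanSpace ℝ (Fin N) :=
  WithLp.toLp 2 fun a => u (i, a)

/-- The Gram matrix `ρ(u) = (⟨u_i, u_j⟩)_{i,j}` of the blocks of `u`. -/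
noncomputable def profile {L N : ℕ} (u : EuclideanSpace ℝ (Fin L × Fin N)) :
    Matrix (Fin L) (Fin L) ℝ :=
  Matrix.gram ℝ (block u)

/-- The operator norm of a matrix with respect to the Euclidean norm. -/
noncomputable def matOpNorm {L : ℕ} (B : Matrix (Fin L) (Fin L) ℝ) : ℝ :=
  ‖Matrix.toEuclideanCLM (n := Fin L) (𝕜 := ℝ) B‖

/-- The uniform probability measure on the unit sphere `S^{NL-1}` of `ℝ^{NL}`. -/
noncomputable def uniformSphere (L N : ℕ) :
    Measure (Metric.sphere (0 : EuclideanSpace ℝ (Fin L × Fin N)) 1) :=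
  ((volume : Measure (EuclideanSpace ℝ (Fin L × Fin N))).toSphere Set.univ)⁻¹ •
    (volume : Measure (EuclideanSpace ℝ (Fin L × Fin N))).toSphere

/-- The annealed spherical integral
`E_u E_W [exp (θ N L ⟨u, X u⟩) 1_{‖ρ(u) - Ψ‖ ≤ δ}]`, with values in `[0, ∞]`. -/
noncomputable def annealed {L N k : ℕ} {Ω : Type*} [MeasurableSpace Ω] (P : Measure Ω)
    (A₀ : Matrix (Fin L) (Fin L) ℝ) (A : Fin k → Matrix (Fin L) (Fin L) ℝ)
    (W : Fin k → Ω → Matrix (Fin N) (Fin N) ℝ) (θ : ℝ) (Ψ : Matrix (Fin L) (Fin L) ℝ)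
    (δ : ℝ) : ℝ≥0∞ :=
  ∫⁻ u : Metric.sphere (0 : EuclideanSpace ℝ (Fin L × Fin N)) 1,
    ∫⁻ ω,
      ENNReal.ofReal (Real.exp (θ * N * L *
          (u.1.ofLp ⬝ᵥ (kronModel A₀ A (fun j => W j ω) *ᵥ u.1.ofLp)))) *
        Set.indicator {v | matOpNorm (profile v - Ψ) ≤ δ} 1 u.1
      ∂P
    ∂(uniformSphere L N)

/-- The normalized logarithm `(1 / N) log E_u E_W [⋯]`, with values in `[-∞, ∞]`
(`log 0 = -∞`). -/
noncomputable def logAnnealed {L N k : ℕ} {Ω : Type*} [MeasurableSpace Ω] (P : Measure Ω)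
    (A₀ : Matrix (Fin L) (Fin L) ℝ) (A : Fin k → Matrix (Fin L) (Fin L) ℝ)
    (W : Fin k → Ω → Matrix (Fin N) (Fin N) ℝ) (θ : ℝ) (Ψ : Matrix (Fin L) (Fin L) ℝ)
    (δ : ℝ) : EReal :=
  (((1 : ℝ) / N : ℝ) : EReal) * ENNReal.log (annealed P A₀ A W θ Ψ δ)

/-- `S(T) = ∑ j, A j T A j`. -/
def covOp {L k : ℕ} (A : Fin k → Matrix (Fin L) (Fin L) ℝ) (T : Matrix (Fin L) (Fin L) ℝ) :
    Matrix (Fin L) (Fin L) ℝ :=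
  ∑ j, A j * T * A j

/-- `K(θ, Ψ) = L² θ² Tr[Ψᵀ S(Ψᵀ)] + L θ Tr[A₀ᵀ Ψ] + (log det Ψ + L log L) / 2`, which is `-∞`
when `det Ψ = 0`. -/
noncomputable def K {L k : ℕ} (A₀ : Matrix (Fin L) (Fin L) ℝ)
    (A : Fin k → Matrix (Fin L) (Fin L) ℝ) (θ : ℝ) (Ψ : Matrix (Fin L) (Fin L) ℝ) : EReal :=
  (((L : ℝ) ^ 2 * θ ^ 2 * (Ψᵀ * covOp A Ψᵀ).trace + L * θ * (A₀ᵀ * Ψ).trace : ℝ) : EReal) +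
    ((1 / 2 : ℝ) : EReal) *
      (ENNReal.log (ENNReal.ofReal Ψ.det) + ((L * Real.log L : ℝ) : EReal))

end KroneckerLDP

/-! Integrating out the GOE matrices for fixed `u` is a Gaussian computation: the exponent is linear
in the independent entries, and the result is exactly `exp (N * tilt)` evaluated at the profile of
`u` (`lintegral_exp_kronModel`). Since `tilt` is continuous, restricting the profile to a small ball
around `Ψ` freezes this factor. What remains is the probability that a uniform unit vector has
profile near `Ψ`, which must be of order `exp (N (log det Ψ + L log L) / 2)`.

By definition of the surface measure this probability is a ratio of Lebesgue volumes of cones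
(`uniformSphere_profile`). The Gaussian density of an `L × N` array depends only on the trace of its
Gram matrix, and the map `M ⊗ 1` conjugates the Gram matrix by `M` with Jacobian `det M ^ N`.
Choosing `M * Mᵀ` close to `Ψ` therefore compares the volume with a standard Gaussian probability.
That probability is at most one, which gives the upper bound (`volume_gramMat_le`). It is at least
one half when the conjugate of the identity is interior to the target set, by the law of large
numbers, which gives the lower bound (`eventually_le_volume_gramMat`).

If `Ψ` is singular, the upper bound is applied with `Ψ + η • 1`. Its determinant tends to zero with
`η`, while the trace of `(Ψ + η • 1)⁻¹ * Ψ` stays at most `L`, so the exponent tends to `-∞`. -/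

namespace KroneckerLDP

/-! ### Gram matrices under linear changes of variables. -/

/-- The Gram matrix of the rows of an `L × N` array. -/
def gramMat {L N : ℕ} (x : Fin L × Fin N → ℝ) : Matrix (Fin L) (Fin L) ℝ :=
  Matrix.of fun i j => ∑ a, x (i, a) * x (j, a)

lemma gramMat_apply {L N : ℕ} (x : Fin L × Fin N → ℝ) (i j : Fin L) :
    gramMat x i j = ∑ a, x (i, a) * x (j, a) := rfl

lemma continuous_gramMat {L N : ℕ} :
    Continuous (gramMat : (Fin L × Fin N → ℝ) → Matrix (Fin L) (Fin L) ℝ) := by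
  refine continuous_pi fun i => continuous_pi fun j => ?_
  simp only [gramMat_apply]
  fun_prop

lemma trace_gramMat {L N : ℕ} (x : Fin L × Fin N → ℝ) : (gramMat x).trace = ∑ p, x p ^ 2 := by
  simp [Matrix.trace, gramMat_apply, Fintype.sum_prod_type, sq]

lemma gramMat_kronecker_mulVec {L N : ℕ} (M : Matrix (Fin L) (Fin L) ℝ)
    (x : Fin L × Fin N → ℝ) :
    gramMat ((M ⊗ₖ (1 : Matrix (Fin N) (Fin N) ℝ)) *ᵥ x) = M * gramMat x * Mᵀ := by
  have key : ∀ i a, ((M ⊗ₖ (1 : Matrix (Fin N) (Fin N) ℝ)) *ᵥ x) (i, a)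
      = ∑ l, M i l * x (l, a) := by
    intro i a
    simp [Matrix.mulVec, dotProduct, Fintype.sum_prod_type, Matrix.kroneckerMap_apply,
      Matrix.one_apply]
  ext i j
  simp only [gramMat_apply, key, Matrix.mul_apply, Matrix.transpose_apply, Finset.sum_mul,
    Finset.mul_sum]
  rw [Finset.sum_comm]
  conv_lhs => enter [2, l]; rw [Finset.sum_comm]
  refine Finset.sum_congr rfl fun l _ => Finset.sum_congr rfl fun m _ =>
    Finset.sum_congr rfl fun a _ => by ring

/-- The map `M ⊗ 1` conjugates the Gram matrix by `M` and has determinant `M.det ^ N`. This Jacobian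
is the source of the term `log det Ψ` in the rate. -/
lemma volume_gramMat_preimage {L N : ℕ} {M : Matrix (Fin L) (Fin L) ℝ} (hM : M.det ≠ 0)
    (S : Set (Matrix (Fin L) (Fin L) ℝ)) :
    volume {x : Fin L × Fin N → ℝ | gramMat x ∈ S} = ENNReal.ofReal (|M.det| ^ N) *
      volume {x : Fin L × Fin N → ℝ | M * gramMat x * Mᵀ ∈ S} := by
  set f := Matrix.toLin' (M ⊗ₖ (1 : Matrix (Fin N) (Fin N) ℝ))
  have hf : LinearMap.det f = M.det ^ N := by
    simp [f, Matrix.det_kronecker]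
  have h0 : LinearMap.det f ≠ 0 := by rw [hf]; exact pow_ne_zero _ hM
  have h := Measure.addHaar_preimage_linearMap volume h0 {x : Fin L × Fin N → ℝ | gramMat x ∈ S}
  have h1 : f ⁻¹' {x : Fin L × Fin N → ℝ | gramMat x ∈ S} =
      {x : Fin L × Fin N → ℝ | M * gramMat x * Mᵀ ∈ S} := by
    ext x
    simp only [Set.mem_preimage, Set.mem_ofPred_eq, f, Matrix.toLin'_apply,
      gramMat_kronecker_mulVec]
  rw [← h1, h, ← mul_assoc, ← ENNReal.ofReal_mul (by positivity), hf, abs_inv, abs_pow,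
    mul_inv_cancel₀ (by positivity), ENNReal.ofReal_one, one_mul]

/-! ### Comparison of Lebesgue and Gaussian measure. -/

/-- The density of a product of standard Gaussian measures. -/
lemma pi_gaussianReal_eq_withDensity (ι : Type*) [Fintype ι] :
    Measure.pi (fun _ : ι => gaussianReal 0 1) =
      (volume : Measure (ι → ℝ)).withDensity fun x =>
        ENNReal.ofReal (∏ i, gaussianPDFReal 0 1 (x i)) := by
  refine Measure.pi_eq fun s hs => ?_
  rw [withDensity_apply _ (MeasurableSet.univ_pi hs), ← lintegral_indicator (MeasurableSet.univ_pi hs)]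
  -- The indicator of a box is the product of the indicators of its sides, so the integral over the
  -- box factors.
  have h1 : ∀ x : ι → ℝ, (Set.univ.pi s).indicator
      (fun x => ENNReal.ofReal (∏ i, gaussianPDFReal 0 1 (x i))) x =
      ENNReal.ofReal (∏ i, (s i).indicator (gaussianPDFReal 0 1) (x i)) := by
    intro x
    classical
    by_cases hx : x ∈ Set.univ.pi s
    · rw [Set.indicator_of_mem hx]
      congr 1
      refine Finset.prod_congr rfl fun i _ => ?_
      rw [Set.indicator_of_mem (hx i trivial)]
    · rw [Set.indicator_of_notMem hx]
      simp only [Set.mem_pi, Set.mem_univ, true_imp_iff, not_forall] at hx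
      obtain ⟨i, hi⟩ := hx
      rw [Finset.prod_eq_zero (Finset.mem_univ i) (Set.indicator_of_notMem hi _)]
      simp
  have hint : ∀ i, Integrable ((s i).indicator (gaussianPDFReal 0 1)) := fun i =>
    (integrable_gaussianPDFReal 0 1).indicator (hs i)
  have hnn : ∀ i y, 0 ≤ (s i).indicator (gaussianPDFReal 0 1) y := fun i y =>
    Set.indicator_nonneg (fun _ _ => gaussianPDFReal_nonneg _ _ _) _
  have hprod : Integrable fun x : ι → ℝ => ∏ i, (s i).indicator (gaussianPDFReal 0 1) (x i) :=
    Integrable.fintype_prod_dep hint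
  simp_rw [h1]
  rw [← ofReal_integral_eq_lintegral_ofReal hprod
    (ae_of_all _ fun x => Finset.prod_nonneg fun i _ => hnn i _),
    integral_fintype_prod_volume_eq_prod,
    ENNReal.ofReal_prod_of_nonneg fun i _ => integral_nonneg (hnn i)]
  refine Finset.prod_congr rfl fun i _ => ?_
  rw [gaussianReal_apply_eq_integral _ one_ne_zero, integral_indicator (hs i)]

lemma prod_gaussianPDFReal {L N : ℕ} (x : Fin L × Fin N → ℝ) :
    ∏ p, gaussianPDFReal 0 1 (x p) =
      (√(2 * Real.pi))⁻¹ ^ (L * N) * Real.exp (-((gramMat x).trace / 2)) := by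
  simp only [gaussianPDFReal, trace_gramMat]
  rw [Finset.prod_mul_distrib, ← Real.exp_sum]
  simp [Finset.sum_div, ← Finset.sum_neg_distrib, neg_div]

/-- If `tr ρ ≤ t` on a set then its Lebesgue measure is controlled by its Gaussian measure. -/
lemma volume_le_gaussian {L N : ℕ} {S : Set (Fin L × Fin N → ℝ)} (hS : MeasurableSet S) {t : ℝ}
    (h : ∀ x ∈ S, (gramMat x).trace ≤ t) :
    volume S ≤ ENNReal.ofReal (√(2 * Real.pi) ^ (L * N) * Real.exp (t / 2)) := by
  set c := (√(2 * Real.pi))⁻¹ ^ (L * N) * Real.exp (-(t / 2)) with hc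
  have hcpos : 0 < c := by positivity
  -- The constant `c` is the Gaussian density at Gram trace `t`, hence a lower bound for the density
  -- on `S`, and the Gaussian mass of `S` is at most one.
  have h1 : ENNReal.ofReal c * volume S ≤ 1 := by
    calc ENNReal.ofReal c * volume S = ∫⁻ _ in S, ENNReal.ofReal c := by
          rw [setLIntegral_const]
      _ ≤ ∫⁻ x in S, ENNReal.ofReal (∏ i, gaussianPDFReal 0 1 (x i)) := by
          refine setLIntegral_mono' hS fun x hx => ENNReal.ofReal_le_ofReal ?_
          rw [prod_gaussianPDFReal, hc]
          have := h x hx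
          gcongr
      _ = Measure.pi (fun _ : Fin L × Fin N => gaussianReal 0 1) S := by
          rw [pi_gaussianReal_eq_withDensity, withDensity_apply _ hS]
      _ ≤ 1 := prob_le_one
  have h2 : volume S ≤ (ENNReal.ofReal c)⁻¹ := by
    rw [ENNReal.le_inv_iff_mul_le, mul_comm]; exact h1
  refine h2.trans_eq ?_
  rw [← ENNReal.ofReal_inv_of_pos hcpos, hc, mul_inv, ← inv_pow, inv_inv, ← Real.exp_neg, neg_neg]

lemma gaussian_le_volume {L N : ℕ} {S : Set (Fin L × Fin N → ℝ)} (hS : MeasurableSet S) {t : ℝ}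
    (h : ∀ x ∈ S, t ≤ (gramMat x).trace) :
    ENNReal.ofReal (√(2 * Real.pi) ^ (L * N) * Real.exp (t / 2)) *
      Measure.pi (fun _ : Fin L × Fin N => gaussianReal 0 1) S ≤ volume S := by
  set c := (√(2 * Real.pi))⁻¹ ^ (L * N) * Real.exp (-(t / 2)) with hc
  have hcpos : 0 < c := by positivity
  have h1 : Measure.pi (fun _ : Fin L × Fin N => gaussianReal 0 1) S ≤
      ENNReal.ofReal c * volume S := by
    calc _ = ∫⁻ x in S, ENNReal.ofReal (∏ i, gaussianPDFReal 0 1 (x i)) := by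
          rw [pi_gaussianReal_eq_withDensity, withDensity_apply _ hS]
      _ ≤ ∫⁻ _ in S, ENNReal.ofReal c := by
          refine setLIntegral_mono' hS fun x hx => ENNReal.ofReal_le_ofReal ?_
          rw [prod_gaussianPDFReal, hc]
          have := h x hx
          gcongr
      _ = _ := by rw [setLIntegral_const]
  calc _ ≤ ENNReal.ofReal c⁻¹ * (ENNReal.ofReal c * volume S) := by
        rw [hc, mul_inv, ← inv_pow, inv_inv, ← Real.exp_neg, neg_neg]
        gcongr
    _ = volume S := by
        rw [← mul_assoc, ← ENNReal.ofReal_mul (by positivity), inv_mul_cancel₀ hcpos.ne',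
          ENNReal.ofReal_one, one_mul]

/-! ### Law of large numbers for Gaussian Gram matrices. -/

lemma exists_entrywise_of_mem_nhds {L : ℕ} {A : Matrix (Fin L) (Fin L) ℝ}
    {U : Set (Matrix (Fin L) (Fin L) ℝ)} (hU : U ∈ 𝓝 A) :
    ∃ c > 0, ∀ G : Matrix (Fin L) (Fin L) ℝ, (∀ i j, |G i j - A i j| < c) → G ∈ U := by
  -- Matrices carry the product topology, which is metrized here by the sup distance of iterated
  -- functions.
  obtain ⟨c, hc, h⟩ := (Metric.mem_nhds_iff (α := Fin L → Fin L → ℝ)).1 hU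
  refine ⟨c, hc, fun G hG => h ?_⟩
  exact (dist_pi_lt_iff (X := fun _ => Fin L → ℝ) hc).2 fun i =>
    (dist_pi_lt_iff (X := fun _ => ℝ) hc).2 fun j => hG i j

/-- The product of standard Gaussian measures on `L × N` arrays. -/
noncomputable abbrev stdGauss (L N : ℕ) : Measure (Fin L × Fin N → ℝ) :=
  Measure.pi fun _ => gaussianReal 0 1

lemma memLp_eval_stdGauss {L N : ℕ} (p : ℝ≥0) (q : Fin L × Fin N) :
    MemLp (fun x : Fin L × Fin N → ℝ => x q) p (stdGauss L N) :=
  (memLp_id_gaussianReal p).comp_measurePreserving (measurePreserving_eval _ q)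

lemma integral_eval_stdGauss {L N : ℕ} (q : Fin L × Fin N) {f : ℝ → ℝ} (hf : Continuous f) :
    ∫ x, f (x q) ∂(stdGauss L N) = ∫ y, f y ∂(gaussianReal 0 1) := by
  have h := measurePreserving_eval (fun _ : Fin L × Fin N => gaussianReal 0 1) q
  rw [← h.map_eq, integral_map h.measurable.aemeasurable hf.aestronglyMeasurable]

lemma memLp_mul_stdGauss {L N : ℕ} (q r : Fin L × Fin N) :
    MemLp (fun x : Fin L × Fin N → ℝ => x q * x r) 2 (stdGauss L N) := by
  have : ENNReal.HolderTriple 4 4 2 := ⟨by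
    rw [show (4 : ℝ≥0∞) = 2 * 2 by norm_num,
      ENNReal.mul_inv (by simp) (by simp), ← two_mul, ← mul_assoc,
      ENNReal.mul_inv_cancel (by simp) (by simp), one_mul]⟩
  exact MemLp.mul' (by exact_mod_cast memLp_eval_stdGauss 4 r)
    (by exact_mod_cast memLp_eval_stdGauss 4 q)

lemma iIndepFun_eval_stdGauss (L N : ℕ) :
    iIndepFun (fun (q : Fin L × Fin N) (x : Fin L × Fin N → ℝ) => x q) (stdGauss L N) :=
  iIndepFun_pi (X := fun _ y => y) fun _ => aemeasurable_id

lemma integral_mul_stdGauss {L N : ℕ} (q r : Fin L × Fin N) :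
    ∫ x, x q * x r ∂(stdGauss L N) = if q = r then 1 else 0 := by
  split_ifs with h
  · subst h
    have h1 := variance_eq_sub (memLp_id_gaussianReal (μ := 0) (v := 1) 2)
    rw [variance_id_gaussianReal, show ∫ y, id y ∂(gaussianReal 0 1) = 0 from
      integral_id_gaussianReal] at h1
    rw [integral_eval_stdGauss q (f := fun y => y * y) (by fun_prop)]
    simpa [sq] using h1.symm
  · rw [((iIndepFun_eval_stdGauss L N).indepFun h).integral_fun_mul_eq_mul_integral
      (memLp_eval_stdGauss 1 q).1 (memLp_eval_stdGauss 1 r).1, integral_eval_stdGauss q (f := fun y => y) continuous_id]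
    have : ∫ y, y ∂(gaussianReal 0 1) = 0 := integral_id_gaussianReal
    simp [this]

/-- The bound `(xy)² ≤ (x⁴ + y⁴) / 2` treats diagonal and off-diagonal Gram entries at once; any
constant independent of `N` suffices. -/
lemma variance_mul_stdGauss_le {L N : ℕ} (q r : Fin L × Fin N) :
    Var[fun x : Fin L × Fin N → ℝ => x q * x r; stdGauss L N] ≤
      ∫ y, y ^ 4 ∂(gaussianReal 0 1) := by
  have h4 : ∀ s : Fin L × Fin N, Integrable (fun x => x s ^ 4) (stdGauss L N) := fun s => by
    have := (memLp_eval_stdGauss (L := L) (N := N) 4 s).integrable_norm_pow (p := 4) (by norm_num)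
    simpa [Even.pow_abs (n := 4) (by decide)] using this
  have h22 : Integrable (fun x => (x q * x r) ^ 2) (stdGauss L N) :=
    (memLp_mul_stdGauss q r).integrable_sq
  calc _ ≤ ∫ x, (x q * x r) ^ 2 ∂(stdGauss L N) := by
        rw [variance_eq_sub (memLp_mul_stdGauss q r)]
        simpa using sq_nonneg _
    _ ≤ ∫ x, (x q ^ 4 / 2 + x r ^ 4 / 2) ∂(stdGauss L N) := by
        refine integral_mono h22 (((h4 q).div_const 2).add ((h4 r).div_const 2)) fun x => ?_
        simp only
        nlinarith [sq_nonneg (x q ^ 2 - x r ^ 2)]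
    _ = _ := by
        rw [integral_add ((h4 q).div_const 2) ((h4 r).div_const 2), integral_div, integral_div,
          integral_eval_stdGauss q (f := fun y => y ^ 4) (by fun_prop),
          integral_eval_stdGauss r (f := fun y => y ^ 4) (by fun_prop)]
        ring

lemma integral_gramMat_stdGauss {L N : ℕ} (i j : Fin L) :
    ∫ x, gramMat x i j ∂(stdGauss L N) = N * (1 : Matrix (Fin L) (Fin L) ℝ) i j := by
  simp only [gramMat_apply]
  rw [integral_finsetSum _ fun a _ => (memLp_mul_stdGauss _ _).integrable (by norm_num)]
  simp only [integral_mul_stdGauss, Matrix.one_apply, Prod.mk.injEq, and_true]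
  simp

/-- The summands indexed by distinct columns are independent, so the variance grows only linearly in
`N`. -/
lemma variance_gramMat_stdGauss_le {L N : ℕ} (i j : Fin L) :
    Var[fun x => gramMat x i j; stdGauss L N] ≤ N * ∫ y, y ^ 4 ∂(gaussianReal 0 1) := by
  have h1 : (fun x : Fin L × Fin N → ℝ => gramMat x i j) =
      ∑ a, fun x : Fin L × Fin N → ℝ => x (i, a) * x (j, a) := by
    ext x; simp [gramMat_apply]
  rw [h1, IndepFun.variance_sum (fun a _ => memLp_mul_stdGauss _ _)]
  · refine (Finset.sum_le_sum fun a _ => variance_mul_stdGauss_le _ _).trans_eq ?_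
    simp
  · intro a _ b _ hab
    have := (iIndepFun_eval_stdGauss L N).indepFun_prodMk_prodMk (fun q => measurable_pi_apply q)
      (i, a) (j, a) (i, b) (j, b) (by simp [hab]) (by simp [hab]) (by simp [hab]) (by simp [hab])
    exact this.comp (φ := fun p : ℝ × ℝ => p.1 * p.2) (ψ := fun p : ℝ × ℝ => p.1 * p.2)
      (by fun_prop) (by fun_prop)

/-- The arrays whose Gram matrix is entrywise close to `N • 1`. -/
def gramBox (L N : ℕ) (c : ℝ) : Set (Fin L × Fin N → ℝ) :=
  {x | ∀ i j, |gramMat x i j - N * (1 : Matrix (Fin L) (Fin L) ℝ) i j| < N * c}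

lemma measurableSet_gramBox (L N : ℕ) (c : ℝ) : MeasurableSet (gramBox L N c) := by
  have : gramBox L N c = ⋂ i, ⋂ j, {x : Fin L × Fin N → ℝ |
      |gramMat x i j - N * (1 : Matrix (Fin L) (Fin L) ℝ) i j| < N * c} := by
    ext; simp [gramBox]
  rw [this]
  refine MeasurableSet.iInter fun i => MeasurableSet.iInter fun j => ?_
  have : Continuous fun x : Fin L × Fin N → ℝ => gramMat x i j :=
    continuous_gramMat.matrix_elem i j
  exact (isOpen_lt (by fun_prop) continuous_const).measurableSet

/-- Law of large numbers for the Gram matrix of Gaussian blocks. -/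
lemma eventually_half_le_stdGauss (L : ℕ) {c : ℝ} (hc : 0 < c) :
    ∀ᶠ N : ℕ in atTop, 1 / 2 ≤ stdGauss L N (gramBox L N c) := by
  set C := ∫ y, y ^ 4 ∂(gaussianReal 0 1)
  -- Chebyshev bounds the failure probability of each entry by `N * C / (N * c) ^ 2`, and a union
  -- bound runs over the `L * L` entries.
  have hlim : Tendsto (fun N : ℕ => (L * L : ℝ) * (C / c ^ 2) * (1 / (N : ℝ))) atTop (𝓝 0) := by
    simpa using tendsto_one_div_atTop_nhds_zero_nat.const_mul ((L * L : ℝ) * (C / c ^ 2))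
  filter_upwards [hlim.eventually_le_const (u := 1 / 2) (by norm_num), eventually_gt_atTop 0]
    with N hN hN0
  have hNpos : (0 : ℝ) < N := by exact_mod_cast hN0
  set S := gramBox L N c with hS
  have hmeas : MeasurableSet S := measurableSet_gramBox L N c
  have hmem : ∀ i j, MemLp (fun x => gramMat x i j) 2 (stdGauss L N) := fun i j => by
    simp only [gramMat_apply]
    exact memLp_finsetSum _ fun a _ => memLp_mul_stdGauss _ _
  have hcompl : stdGauss L N Sᶜ ≤ 1 / 2 := by
    have hsub : Sᶜ ⊆ ⋃ i ∈ Finset.univ, ⋃ j ∈ Finset.univ, {x : Fin L × Fin N → ℝ |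
      N * c ≤ |gramMat x i j - ∫ x, gramMat x i j ∂(stdGauss L N)|} := by
      intro x hx
      simp only [hS, gramBox, Set.mem_compl_iff, Set.mem_ofPred_eq, not_forall, not_lt] at hx
      obtain ⟨i, j, h⟩ := hx
      simp only [Finset.mem_univ, Set.iUnion_true, Set.mem_iUnion, Set.mem_ofPred_eq]
      exact ⟨i, j, by rwa [integral_gramMat_stdGauss]⟩
    calc _ ≤ ∑ i : Fin L, ∑ j : Fin L, stdGauss L N {x : Fin L × Fin N → ℝ |
            N * c ≤ |gramMat x i j - ∫ x, gramMat x i j ∂(stdGauss L N)|} := by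
          refine (measure_mono hsub).trans ((measure_biUnion_finset_le _ _).trans ?_)
          exact Finset.sum_le_sum fun i _ => measure_biUnion_finset_le _ _
      _ ≤ ∑ i : Fin L, ∑ j : Fin L, ENNReal.ofReal (C / c ^ 2 * (1 / (N : ℝ))) := by
          refine Finset.sum_le_sum fun i _ => Finset.sum_le_sum fun j _ => ?_
          refine (meas_ge_le_variance_div_sq (hmem i j) (by positivity)).trans ?_
          refine ENNReal.ofReal_le_ofReal ?_
          calc _ ≤ N * C / (N * c) ^ 2 := by
                gcongr; exact variance_gramMat_stdGauss_le i j
            _ = _ := by field_simp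
      _ = ENNReal.ofReal ((L * L : ℝ) * (C / c ^ 2) * (1 / (N : ℝ))) := by
          simp only [Finset.sum_const, Finset.card_univ, Fintype.card_fin, nsmul_eq_mul]
          rw [mul_assoc, mul_assoc, ENNReal.ofReal_mul (p := (L : ℝ)) (by positivity),
            ENNReal.ofReal_mul (p := (L : ℝ)) (by positivity), ENNReal.ofReal_natCast]
      _ ≤ ENNReal.ofReal (1 / 2) := ENNReal.ofReal_le_ofReal hN
      _ = 1 / 2 := by
          rw [ENNReal.ofReal_div_of_pos (by norm_num)]; simp
  have h1 : 1 ≤ stdGauss L N S + 1 / 2 := by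
    calc (1 : ℝ≥0∞) = stdGauss L N S + stdGauss L N Sᶜ := (prob_add_prob_compl hmeas).symm
      _ ≤ _ := by gcongr
  have h2 : (1 : ℝ≥0∞) / 2 + 1 / 2 ≤ stdGauss L N S + 1 / 2 := by
    rwa [ENNReal.add_halves]
  exact (ENNReal.add_le_add_iff_right (by simp)).1 h2

/-! ### Exponential bounds for volumes of Gram matrix sets. -/

lemma smul_conj {L : ℕ} (s : ℝ) (M G : Matrix (Fin L) (Fin L) ℝ) :
    (s • M) * G * (s • M)ᵀ = M * (s ^ 2 • G) * Mᵀ := by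
  simp [Matrix.transpose_smul, smul_smul, sq]

/-- Gaussian upper bound for the volume of the arrays with Gram matrix in a given set. -/
lemma volume_gramMat_le {L N : ℕ} (hN : 0 < N) {M : Matrix (Fin L) (Fin L) ℝ} (hM : M.det ≠ 0)
    {S : Set (Matrix (Fin L) (Fin L) ℝ)}
    (hS : MeasurableSet {x : Fin L × Fin N → ℝ | gramMat x ∈ S}) {t : ℝ}
    (h : ∀ x : Fin L × Fin N → ℝ, ∀ s : ℝ, M * (s • gramMat x) * Mᵀ ∈ S →
      (s • gramMat x).trace ≤ t) :
    volume {x : Fin L × Fin N → ℝ | gramMat x ∈ S} ≤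
      ENNReal.ofReal ((√(2 * Real.pi) / √N) ^ (L * N) * |M.det| ^ N * Real.exp (N * t / 2)) := by
  have hNpos : (0 : ℝ) < N := by exact_mod_cast hN
  have hsq : 0 < √(N : ℝ) := Real.sqrt_pos.2 hNpos
  have hs2 : (√(N : ℝ))⁻¹ ^ 2 = (N : ℝ)⁻¹ := by rw [inv_pow, Real.sq_sqrt hNpos.le]
  have hdet : ((√(N : ℝ))⁻¹ • M).det = (√(N : ℝ))⁻¹ ^ L * M.det := by simp
  have hdet0 : ((√(N : ℝ))⁻¹ • M).det ≠ 0 := by rw [hdet]; positivity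
  -- Rescaling `M` by `1 / √N` puts the normalized matrix `gramMat x / N`, of order one for Gaussian
  -- arrays, in the condition.
  rw [volume_gramMat_preimage hdet0]
  simp_rw [smul_conj, hs2]
  have hmeas : MeasurableSet {x : Fin L × Fin N → ℝ | M * ((N : ℝ)⁻¹ • gramMat x) * Mᵀ ∈ S} := by
    have hc : Continuous fun x : Fin L × Fin N → ℝ =>
      (((√(N : ℝ))⁻¹ • M) ⊗ₖ (1 : Matrix (Fin N) (Fin N) ℝ)) *ᵥ x := by fun_prop
    have := hc.measurable hS
    simpa only [Set.preimage_ofPred_eq, gramMat_kronecker_mulVec, smul_conj, hs2] using this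
  calc _ ≤ ENNReal.ofReal (|((√(N : ℝ))⁻¹ • M).det| ^ N) *
        ENNReal.ofReal (√(2 * Real.pi) ^ (L * N) * Real.exp (N * t / 2)) := by
        gcongr
        refine volume_le_gaussian hmeas fun x hx => ?_
        have := h x _ hx
        rw [Matrix.trace_smul, smul_eq_mul, inv_mul_le_iff₀ hNpos] at this
        exact this
    _ = _ := by
        rw [← ENNReal.ofReal_mul (by positivity), hdet, abs_mul, abs_of_pos (by positivity), mul_pow,
          ← pow_mul, div_pow, inv_pow]
        congr 1
        field_simp

/-- Gaussian lower bound for the volume of the arrays with Gram matrix in a given set. -/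
lemma eventually_le_volume_gramMat {L : ℕ} {M : Matrix (Fin L) (Fin L) ℝ} (hM : M.det ≠ 0)
    {S : Set (Matrix (Fin L) (Fin L) ℝ)} (h : ∀ᶠ G in 𝓝 1, M * G * Mᵀ ∈ S) {ε : ℝ} (hε : 0 < ε) :
    ∀ᶠ N : ℕ in atTop,
      ENNReal.ofReal ((√(2 * Real.pi) / √N) ^ (L * N) * |M.det| ^ N *
        Real.exp (N * (L - ε) / 2)) ≤ volume {x : Fin L × Fin N → ℝ | gramMat x ∈ S} := by
  have htr : ∀ᶠ G : Matrix (Fin L) (Fin L) ℝ in 𝓝 1, L - ε / 2 ≤ G.trace := by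
    have hc : ContinuousAt (fun G : Matrix (Fin L) (Fin L) ℝ => G.trace) 1 := by fun_prop
    have := hc.eventually (lt_mem_nhds (a := L - ε / 2) (by simp [hε]))
    exact this.mono fun G hG => hG.le
  obtain ⟨c, hc, hcS⟩ := exists_entrywise_of_mem_nhds (h.and htr)
  -- Asking the trace to be at least `L - ε / 2` rather than `L - ε` leaves a surplus factor `exp (N
  -- ε / 4)`, which absorbs the `1 / 2` of the law of large numbers.
  have hexp : Tendsto (fun N : ℕ => Real.exp (N * (ε / 4))) atTop atTop :=
    Real.tendsto_exp_atTop.comp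
      (tendsto_natCast_atTop_atTop.atTop_mul_const (by positivity))
  filter_upwards [eventually_half_le_stdGauss L hc, eventually_gt_atTop 0,
    hexp.eventually_ge_atTop 2] with N hhalf hN hN2
  have hNpos : (0 : ℝ) < N := by exact_mod_cast hN
  have hsq : 0 < √(N : ℝ) := Real.sqrt_pos.2 hNpos
  have hs2 : (√(N : ℝ))⁻¹ ^ 2 = (N : ℝ)⁻¹ := by rw [inv_pow, Real.sq_sqrt hNpos.le]
  have hdet : ((√(N : ℝ))⁻¹ • M).det = (√(N : ℝ))⁻¹ ^ L * M.det := by simp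
  have hdet0 : ((√(N : ℝ))⁻¹ • M).det ≠ 0 := by rw [hdet]; positivity
  rw [volume_gramMat_preimage hdet0]
  simp_rw [smul_conj, hs2]
  set B := gramBox L N c
  have hBmem : ∀ x ∈ B, M * ((N : ℝ)⁻¹ • gramMat x) * Mᵀ ∈ S ∧
      L - ε / 2 ≤ ((N : ℝ)⁻¹ • gramMat x).trace := by
    intro x hx
    refine hcS _ fun i j => ?_
    have h1 := hx i j
    rw [Matrix.smul_apply, smul_eq_mul, show (N : ℝ)⁻¹ * gramMat x i j -
      (1 : Matrix (Fin L) (Fin L) ℝ) i j = (N : ℝ)⁻¹ * (gramMat x i j -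
        N * (1 : Matrix (Fin L) (Fin L) ℝ) i j) by field_simp, abs_mul,
      abs_of_pos (inv_pos.2 hNpos), inv_mul_lt_iff₀ hNpos]
    exact h1
  have hlow := gaussian_le_volume (measurableSet_gramBox L N c) (t := N * (L - ε / 2)) fun x hx => by
    have := (hBmem x hx).2
    rwa [Matrix.trace_smul, smul_eq_mul, le_inv_mul_iff₀ hNpos] at this
  calc _ ≤ ENNReal.ofReal (|((√(N : ℝ))⁻¹ • M).det| ^ N) *
        (ENNReal.ofReal (√(2 * Real.pi) ^ (L * N) * Real.exp (N * (L - ε / 2) / 2)) *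
          ENNReal.ofReal (1 / 2)) := by
        rw [← ENNReal.ofReal_mul (by positivity), ← ENNReal.ofReal_mul (by positivity)]
        refine ENNReal.ofReal_le_ofReal ?_
        rw [hdet, abs_mul, abs_of_pos (by positivity : (0 : ℝ) < (√(N : ℝ))⁻¹ ^ L), mul_pow,
          ← pow_mul, div_pow, inv_pow]
        have hsplit : Real.exp (N * (L - ε / 2) / 2) =
            Real.exp (N * (L - ε) / 2) * Real.exp (N * (ε / 4)) := by
          rw [← Real.exp_add]; congr 1; ring
        rw [hsplit]
        have : Real.exp (N * (L - ε) / 2) ≤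
            Real.exp (N * (L - ε) / 2) * Real.exp (N * (ε / 4)) * (1 / 2) := by
          nlinarith [Real.exp_pos (N * (L - ε) / 2)]
        calc _ ≤ √(2 * Real.pi) ^ (L * N) / √(N : ℝ) ^ (L * N) * |M.det| ^ N *
              (Real.exp (N * (L - ε) / 2) * Real.exp (N * (ε / 4)) * (1 / 2)) := by gcongr
          _ = _ := by field_simp
    _ ≤ _ := by
        gcongr
        refine le_trans ?_ (hlow.trans (measure_mono fun x hx => (hBmem x hx).1))
        gcongr
        refine le_trans (le_of_eq ?_) hhalf
        rw [ENNReal.ofReal_div_of_pos (by norm_num)]; simp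

/-! ### The uniform measure on the sphere as a ratio of cone volumes. -/

/-- The matrices of trace in `(0, 1)` whose normalization lies in `S`. -/
def normSet {L : ℕ} (S : Set (Matrix (Fin L) (Fin L) ℝ)) : Set (Matrix (Fin L) (Fin L) ℝ) :=
  {G | (0 < G.trace ∧ G.trace < 1) ∧ G.trace⁻¹ • G ∈ S}

lemma profile_eq_gramMat {L N : ℕ} (u : EuclideanSpace ℝ (Fin L × Fin N)) :
    profile u = gramMat u.ofLp := by
  ext i j
  simp [profile, Matrix.gram, gramMat_apply, block, PiLp.inner_apply, mul_comm]

lemma trace_gramMat_eq_norm_sq {L N : ℕ} (u : EuclideanSpace ℝ (Fin L × Fin N)) :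
    (gramMat u.ofLp).trace = ‖u‖ ^ 2 := by
  rw [trace_gramMat, EuclideanSpace.norm_sq_eq]
  simp

lemma gramMat_smul {L N : ℕ} (c : ℝ) (x : Fin L × Fin N → ℝ) :
    gramMat (c • x) = c ^ 2 • gramMat x := by
  ext i j
  simp only [gramMat_apply, Matrix.smul_apply, Pi.smul_apply, smul_eq_mul, Finset.mul_sum]
  exact Finset.sum_congr rfl fun a _ => by ring

/-- Normalization by the trace is continuous only where the trace is nonzero, so the set is written
as an open set minus an open subset of it. -/
lemma measurableSet_gramMat_normSet {L N : ℕ} {S : Set (Matrix (Fin L) (Fin L) ℝ)}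
    (hS : IsClosed S) : MeasurableSet {x : Fin L × Fin N → ℝ | gramMat x ∈ normSet S} := by
  have htr : Continuous fun x : Fin L × Fin N → ℝ => (gramMat x).trace :=
    continuous_gramMat.matrix_trace
  set O := {x : Fin L × Fin N → ℝ | 0 < (gramMat x).trace ∧ (gramMat x).trace < 1} with hO
  have hOo : IsOpen O := (isOpen_lt continuous_const htr).inter (isOpen_lt htr continuous_const)
  have hf : ContinuousOn (fun x : Fin L × Fin N → ℝ => (gramMat x).trace⁻¹ • gramMat x) O := by
    refine ContinuousOn.smul (htr.continuousOn.inv₀ fun x hx => hx.1.ne')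
      continuous_gramMat.continuousOn
  have h2 := hf.isOpen_inter_preimage hOo hS.isOpen_compl
  have : {x : Fin L × Fin N → ℝ | gramMat x ∈ normSet S} =
      O \ (O ∩ (fun x : Fin L × Fin N → ℝ => (gramMat x).trace⁻¹ • gramMat x) ⁻¹' Sᶜ) := by
    ext x
    simp only [normSet, hO, Set.mem_ofPred_eq, Set.mem_sdiff, Set.mem_inter_iff, Set.mem_preimage,
      Set.mem_compl_iff]
    tauto
  rw [this]
  exact hOo.measurableSet.diff h2.measurableSet

lemma continuous_profile {L N : ℕ} :
    Continuous (profile : EuclideanSpace ℝ (Fin L × Fin N) → Matrix (Fin L) (Fin L) ℝ) := by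
  have : (profile : EuclideanSpace ℝ (Fin L × Fin N) → Matrix (Fin L) (Fin L) ℝ) =
      fun u => gramMat u.ofLp := funext profile_eq_gramMat
  rw [this]
  exact continuous_gramMat.comp (PiLp.continuous_ofLp 2 _)

/-- The surface measure is the dimension times the volume of the cone of radii in `(0, 1)`. Because
the Gram trace is the squared norm, dividing the Gram matrix by its trace is radial projection to
the sphere. -/
lemma toSphere_profile {L N : ℕ} {S : Set (Matrix (Fin L) (Fin L) ℝ)} (hS : IsClosed S) :
    (volume : Measure (EuclideanSpace ℝ (Fin L × Fin N))).toSphere {u | profile u.1 ∈ S} =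
      (L * N : ℕ) * volume {x : Fin L × Fin N → ℝ | gramMat x ∈ normSet S} := by
  have hmeas : MeasurableSet {u : Metric.sphere (0 : EuclideanSpace ℝ (Fin L × Fin N)) 1 |
      profile u.1 ∈ S} :=
    (hS.preimage (continuous_profile.comp continuous_subtype_val)).measurableSet
  rw [Measure.toSphere_apply' _ hmeas]
  have hdim : Module.finrank ℝ (EuclideanSpace ℝ (Fin L × Fin N)) = L * N := by simp
  rw [hdim, ← (PiLp.volume_preserving_ofLp (Fin L × Fin N)).measure_preimage
    (measurableSet_gramMat_normSet hS).nullMeasurableSet]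
  congr 2
  ext v
  rw [Set.mem_smul]
  simp only [Set.mem_preimage, Set.mem_ofPred_eq, normSet, trace_gramMat_eq_norm_sq]
  constructor
  · rintro ⟨r, ⟨hr0, hr1⟩, _, ⟨u, hu, rfl⟩, rfl⟩
    have hn : ‖(u : EuclideanSpace ℝ (Fin L × Fin N))‖ = 1 := by simp
    have hnr : ‖r • (u : EuclideanSpace ℝ (Fin L × Fin N))‖ = r := by
      rw [norm_smul, hn, mul_one, Real.norm_of_nonneg hr0.le]
    rw [hnr]
    refine ⟨⟨by positivity, by nlinarith⟩, ?_⟩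
    rw [WithLp.ofLp_smul, gramMat_smul, smul_smul, inv_mul_cancel₀ (by positivity), one_smul,
      ← profile_eq_gramMat]
    exact hu
  · rintro ⟨⟨h0, h1⟩, hv⟩
    have hpos : 0 < ‖v‖ := by
      rcases (norm_nonneg v).eq_or_lt with h | h
      · rw [← h] at h0; norm_num at h0
      · exact h
    refine ⟨‖v‖, ⟨hpos, by nlinarith⟩, ‖v‖⁻¹ • v, ?_, ?_⟩
    · refine ⟨⟨‖v‖⁻¹ • v, ?_⟩, ?_, rfl⟩
      · simp [norm_smul, hpos.ne']
      · change profile (‖v‖⁻¹ • v) ∈ S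
        rw [profile_eq_gramMat, WithLp.ofLp_smul, gramMat_smul, inv_pow]
        exact hv
    · rw [smul_smul, mul_inv_cancel₀ hpos.ne', one_smul]

/-- Under the uniform measure, the law of the profile is a ratio of volumes of cones. -/
lemma uniformSphere_profile {L N : ℕ} (hL : 0 < L) (hN : 0 < N)
    {S : Set (Matrix (Fin L) (Fin L) ℝ)} (hS : IsClosed S) :
    uniformSphere L N {u | profile u.1 ∈ S} =
      volume {x : Fin L × Fin N → ℝ | gramMat x ∈ normSet S} /
      volume {x : Fin L × Fin N → ℝ | gramMat x ∈ normSet Set.univ} := by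
  have huniv := toSphere_profile (L := L) (N := N) (S := Set.univ) isClosed_univ
  simp only [Set.mem_univ, Set.ofPred_true] at huniv
  have hLN : ((L * N : ℕ) : ℝ≥0∞) ≠ 0 := by
    simp [hL.ne', hN.ne']
  rw [uniformSphere, Measure.smul_apply, toSphere_profile hS, huniv, smul_eq_mul,
    mul_comm, ← div_eq_mul_inv, ENNReal.mul_div_mul_left _ _ hLN (ENNReal.natCast_ne_top _)]

/-! ### Large deviations of the profile of a uniform unit vector. -/

open scoped MatrixOrder in
lemma exists_eq_mul_transpose {L : ℕ} {Q : Matrix (Fin L) (Fin L) ℝ} (hQ : Q.PosSemidef) :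
    ∃ M : Matrix (Fin L) (Fin L) ℝ, Q = M * Mᵀ := by
  obtain ⟨B, hB⟩ := CStarAlgebra.nonneg_iff_eq_star_mul_self.1 (Matrix.nonneg_iff_posSemidef.2 hQ)
  exact ⟨Bᵀ, by simpa [Matrix.star_eq_conjTranspose] using hB⟩

lemma exists_det_eq_exp {L : ℕ} {Q : Matrix (Fin L) (Fin L) ℝ} (hQ : Q.PosDef) :
    ∃ M : Matrix (Fin L) (Fin L) ℝ, Q = M * Mᵀ ∧ M.det ≠ 0 ∧
      |M.det| = Real.exp (Real.log Q.det / 2) := by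
  obtain ⟨M, hM⟩ := exists_eq_mul_transpose hQ.posSemidef
  have hdet : Q.det = M.det ^ 2 := by rw [hM, Matrix.det_mul, Matrix.det_transpose, sq]
  have h0 : M.det ≠ 0 := fun h => by
    have := hQ.det_pos
    rw [hdet, h] at this
    norm_num at this
  refine ⟨M, hM, h0, ?_⟩
  rw [hdet, Real.log_pow, ← Real.log_abs]
  push_cast
  rw [mul_div_cancel_left₀ _ (two_ne_zero), Real.exp_log (abs_pos.2 h0)]

lemma scalar_conj {L : ℕ} (s : ℝ) (G : Matrix (Fin L) (Fin L) ℝ) :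
    (s • (1 : Matrix (Fin L) (Fin L) ℝ)) * G * (s • (1 : Matrix (Fin L) (Fin L) ℝ))ᵀ =
      s ^ 2 • G := by
  simp [smul_smul, sq]

/-- Scaling by `(L + ε)^(-1/2)` sends the identity to a matrix of trace `L / (L + ε) < 1`, strictly
inside the cone, as the Gaussian lower bound requires. -/
lemma eventually_le_volume_normSet_univ {L : ℕ} (hL : 0 < L) {ε : ℝ} (hε : 0 < ε) :
    ∀ᶠ N : ℕ in atTop, ENNReal.ofReal ((√(2 * Real.pi) / √N) ^ (L * N) *
        Real.exp (N * ((L - ε) / 2 - L / 2 * Real.log (L + ε)))) ≤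
      volume {x : Fin L × Fin N → ℝ | gramMat x ∈ normSet Set.univ} := by
  have hLpos : (0 : ℝ) < L := by exact_mod_cast hL
  have hs : 0 < √((L : ℝ) + ε) := Real.sqrt_pos.2 (by positivity)
  have hs2 : (√((L : ℝ) + ε))⁻¹ ^ 2 = ((L : ℝ) + ε)⁻¹ := by
    rw [inv_pow, Real.sq_sqrt (by positivity)]
  have hdet : ((√((L : ℝ) + ε))⁻¹ • (1 : Matrix (Fin L) (Fin L) ℝ)).det =
      (√((L : ℝ) + ε))⁻¹ ^ L := by simp
  have hS : ∀ᶠ G : Matrix (Fin L) (Fin L) ℝ in 𝓝 1,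
      ((√((L : ℝ) + ε))⁻¹ • (1 : Matrix (Fin L) (Fin L) ℝ)) * G *
        ((√((L : ℝ) + ε))⁻¹ • (1 : Matrix (Fin L) (Fin L) ℝ))ᵀ ∈ normSet Set.univ := by
    simp only [scalar_conj, hs2, normSet, Set.mem_univ, and_true, Matrix.trace_smul, smul_eq_mul,
      Set.mem_ofPred_eq]
    have hc : ContinuousAt
        (fun G : Matrix (Fin L) (Fin L) ℝ => ((L : ℝ) + ε)⁻¹ * G.trace) 1 := by fun_prop
    have h1 : ((L : ℝ) + ε)⁻¹ * (1 : Matrix (Fin L) (Fin L) ℝ).trace = (L + ε)⁻¹ * L := by simp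
    exact (hc.eventually (lt_mem_nhds (by beta_reduce; rw [h1]; positivity))).and
      (hc.eventually (gt_mem_nhds (by beta_reduce; rw [h1, inv_mul_lt_iff₀ (by positivity)]; linarith)))
  filter_upwards [eventually_le_volume_gramMat (by rw [hdet]; positivity) hS hε] with N hN
  refine le_trans (le_of_eq ?_) hN
  rw [hdet, abs_of_pos (by positivity), mul_assoc]
  congr 2
  have : (√((L : ℝ) + ε))⁻¹ = Real.exp (-(Real.log (L + ε) / 2)) := by
    rw [Real.exp_neg, ← Real.log_sqrt (by positivity), Real.exp_log hs]
  rw [this, ← Real.exp_nat_mul, ← Real.exp_nat_mul, ← Real.exp_add]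
  congr 1; ring

/-- Scaling by `L^(-1/2)` turns the constraint trace `< 1` into trace `< L`. The upper bound needs
no interior room, hence no `ε`. -/
lemma volume_normSet_univ_le {L N : ℕ} (hL : 0 < L) (hN : 0 < N) :
    volume {x : Fin L × Fin N → ℝ | gramMat x ∈ normSet Set.univ} ≤
      ENNReal.ofReal ((√(2 * Real.pi) / √N) ^ (L * N) *
        Real.exp (N * (L / 2 - L / 2 * Real.log L))) := by
  have hLpos : (0 : ℝ) < L := by exact_mod_cast hL
  have hs : 0 < √(L : ℝ) := Real.sqrt_pos.2 (by positivity)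
  have hs2 : (√(L : ℝ))⁻¹ ^ 2 = (L : ℝ)⁻¹ := by
    rw [inv_pow, Real.sq_sqrt (by positivity)]
  have hdet : ((√(L : ℝ))⁻¹ • (1 : Matrix (Fin L) (Fin L) ℝ)).det = (√(L : ℝ))⁻¹ ^ L := by simp
  refine (volume_gramMat_le hN (M := (√(L : ℝ))⁻¹ • 1) (by rw [hdet]; positivity)
    (measurableSet_gramMat_normSet isClosed_univ) (t := L) fun x s hx => ?_).trans (le_of_eq ?_)
  · have h1 := hx.1.2
    rw [scalar_conj, hs2, Matrix.trace_smul, smul_eq_mul, inv_mul_lt_iff₀ hLpos, mul_one] at h1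
    exact h1.le
  · rw [hdet, abs_of_pos (by positivity), mul_assoc]
    congr 2
    have : (√(L : ℝ))⁻¹ = Real.exp (-(Real.log L / 2)) := by
      rw [Real.exp_neg, ← Real.log_sqrt (by positivity), Real.exp_log hs]
    rw [this, ← Real.exp_nat_mul, ← Real.exp_nat_mul, ← Real.exp_add]
    congr 1; ring

/-- Large deviation upper bound for the profile of a uniform unit vector. -/
lemma eventually_uniformSphere_profile_le {L : ℕ} (hL : 0 < L) {Q : Matrix (Fin L) (Fin L) ℝ}
    (hQ : Q.PosDef) {S : Set (Matrix (Fin L) (Fin L) ℝ)} (hS : IsClosed S) {ε : ℝ} (hε : 0 < ε)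
    (h : ∀ Y ∈ S, (Q⁻¹ * Y).trace ≤ L + ε) :
    ∀ᶠ N : ℕ in atTop, uniformSphere L N {u | profile u.1 ∈ S} ≤
      ENNReal.ofReal (Real.exp
        (N * (Real.log Q.det / 2 + L / 2 * Real.log (L + ε) + ε))) := by
  have hLpos : (0 : ℝ) < L := by exact_mod_cast hL
  obtain ⟨M, hM, hdet, hdetexp⟩ := exists_det_eq_exp hQ
  have hunit : IsUnit M.det := hdet.isUnit
  filter_upwards [eventually_le_volume_normSet_univ hL hε, eventually_gt_atTop 0] with N hden hN
  have hNpos : (0 : ℝ) < N := by exact_mod_cast hN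
  have hq : 0 < √(2 * Real.pi) / √(N : ℝ) := by positivity
  -- For `X = M * G * Mᵀ` and `Q = M * Mᵀ`, cyclicity gives `tr (Q⁻¹ X) = tr G`. The hypothesis on
  -- `X / tr X` then yields `tr G ≤ (L + ε) tr X`, and `tr X < 1`.
  have hnum := volume_gramMat_le hN hdet (measurableSet_gramMat_normSet hS) (t := L + ε)
    fun x s hx => by
      set X := M * (s • gramMat x) * Mᵀ with hX
      obtain ⟨⟨h0, h1⟩, h2⟩ := hx
      have h3 := h _ h2
      have h4 : (Q⁻¹ * X).trace = (s • gramMat x).trace := by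
        rw [hX, hM, Matrix.mul_inv_rev, Matrix.trace_mul_comm]
        rw [Matrix.mul_assoc, ← Matrix.mul_assoc Mᵀ, Matrix.mul_nonsing_inv _ (by simpa using hunit),
          Matrix.one_mul, Matrix.trace_mul_comm, ← Matrix.mul_assoc,
          Matrix.nonsing_inv_mul _ hunit, Matrix.one_mul]
      rw [Matrix.mul_smul, Matrix.trace_smul, smul_eq_mul, h4, inv_mul_le_iff₀ h0] at h3
      nlinarith
  rw [uniformSphere_profile hL hN hS]
  refine (ENNReal.div_le_div hnum hden).trans (le_of_eq ?_)
  rw [← ENNReal.ofReal_div_of_pos (by positivity)]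
  congr 1
  -- The Gaussian normalizations cancel in the quotient, and `(L + ε) / 2 - (L - ε) / 2` leaves the
  -- error `ε`.
  rw [mul_assoc, mul_div_mul_left _ _ (by positivity), hdetexp, ← Real.exp_nat_mul,
    ← Real.exp_add, ← Real.exp_sub]
  congr 1; ring

/-- Large deviation lower bound for the profile of a uniform unit vector. -/
lemma eventually_le_uniformSphere_profile {L : ℕ} (hL : 0 < L) {Ψ : Matrix (Fin L) (Fin L) ℝ}
    (hΨ : Ψ.PosDef) (htr : Ψ.trace = 1) {S : Set (Matrix (Fin L) (Fin L) ℝ)} (hS : IsClosed S)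
    (hSΨ : S ∈ 𝓝 Ψ) {ε : ℝ} (hε : 0 < ε) :
    ∀ᶠ N : ℕ in atTop, ENNReal.ofReal (Real.exp
        (N * (Real.log Ψ.det / 2 + L / 2 * Real.log L - ε))) ≤
      uniformSphere L N {u | profile u.1 ∈ S} := by
  have hLpos : (0 : ℝ) < L := by exact_mod_cast hL
  obtain ⟨M, hM, hdet, hdetexp⟩ := exists_det_eq_exp hΨ
  -- Since `Ψ` has trace one it lies on the boundary of the cone; shrinking `M` by `s < 1` moves it
  -- inside. The cost `s ^ (L * N) = exp (-N ε / 2)` and the loss `ε / 2` of the volume bound add up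
  -- to `ε`.
  set s := Real.exp (-(ε / (2 * L))) with hs
  have hspos : 0 < s := Real.exp_pos _
  have hs1 : s < 1 := Real.exp_lt_one_iff.2 (neg_lt_zero.2 (by positivity))
  have hdets : (s • M).det = s ^ L * M.det := by simp
  have hlim : ∀ᶠ G in 𝓝 1, (s • M) * G * (s • M)ᵀ ∈ normSet S := by
    have hF : ContinuousAt (fun G : Matrix (Fin L) (Fin L) ℝ => (s • M) * G * (s • M)ᵀ) 1 := by
      fun_prop
    have hF1 : (s • M) * 1 * (s • M)ᵀ = s ^ 2 • Ψ := by rw [smul_conj, hM]; simp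
    have htr1 : ((s • M) * 1 * (s • M)ᵀ).trace = s ^ 2 := by
      rw [hF1, Matrix.trace_smul, htr, smul_eq_mul, mul_one]
    have hT : ContinuousAt
        (fun G : Matrix (Fin L) (Fin L) ℝ => ((s • M) * G * (s • M)ᵀ).trace) 1 := by
      fun_prop
    have hR : ContinuousAt (fun G : Matrix (Fin L) (Fin L) ℝ =>
        ((s • M) * G * (s • M)ᵀ).trace⁻¹ • ((s • M) * G * (s • M)ᵀ)) 1 :=
      (hT.inv₀ (by rw [htr1]; positivity)).smul hF
    have hR1 : ((s • M) * 1 * (s • M)ᵀ).trace⁻¹ • ((s • M) * 1 * (s • M)ᵀ) = Ψ := by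
      rw [htr1, hF1, smul_smul, inv_mul_cancel₀ (by positivity), one_smul]
    refine ((hT.eventually (lt_mem_nhds ?_)).and (hT.eventually (gt_mem_nhds ?_))).and
      (hR.eventually (by beta_reduce; rw [hR1]; exact hSΨ))
    · beta_reduce; rw [htr1]; positivity
    · beta_reduce; rw [htr1]; nlinarith
  filter_upwards [eventually_le_volume_gramMat (by rw [hdets]; positivity) hlim hε,
    eventually_gt_atTop 0] with N hnum hN
  have hNpos : (0 : ℝ) < N := by exact_mod_cast hN
  have hq : 0 < √(2 * Real.pi) / √(N : ℝ) := by positivity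
  rw [uniformSphere_profile hL hN hS]
  refine le_trans (le_of_eq ?_) (ENNReal.div_le_div hnum (volume_normSet_univ_le hL hN))
  rw [← ENNReal.ofReal_div_of_pos (by positivity)]
  congr 1
  rw [mul_assoc, mul_div_mul_left _ _ (by positivity), hdets, abs_mul,
    abs_of_pos (by positivity : 0 < s ^ L), hdetexp, hs, ← Real.exp_nat_mul, ← Real.exp_add,
    ← Real.exp_nat_mul, ← Real.exp_add, ← Real.exp_sub]
  congr 1; field_simp; ring

/-! ### Integration over the GOE matrices. -/

lemma lintegral_exp_mul_of_hasLaw_gaussianReal {Ω : Type*} [MeasurableSpace Ω] {P : Measure Ω}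
    {X : Ω → ℝ} {v : ℝ≥0} (hX : HasLaw X (gaussianReal 0 v) P) (s : ℝ) :
    ∫⁻ ω, ENNReal.ofReal (Real.exp (s * X ω)) ∂P = ENNReal.ofReal (Real.exp (v * s ^ 2 / 2)) := by
  have h1 : ∫⁻ ω, ENNReal.ofReal (Real.exp (s * X ω)) ∂P =
      ∫⁻ y, ENNReal.ofReal (Real.exp (s * y)) ∂(gaussianReal 0 v) := by
    rw [← hX.map_eq, lintegral_map' (by fun_prop) hX.aemeasurable]
  rw [h1, ← ofReal_integral_eq_lintegral_ofReal (integrable_exp_mul_gaussianReal s)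
    (ae_of_all _ fun _ => (Real.exp_pos _).le)]
  have h2 := congrFun (mgf_id_gaussianReal (μ := 0) (v := v)) s
  simp only [mgf, id, zero_mul, zero_add] at h2
  rw [h2]

/-- A symmetric double sum, written over the upper triangle. -/
lemma sum_prod_eq_sum_upper {N : ℕ} (F : Fin N → Fin N → ℝ) (hF : ∀ a b, F a b = F b a) :
    ∑ a, ∑ b, F a b = ∑ q : {q : Fin N × Fin N // q.1 ≤ q.2},
      (if q.1.1 = q.1.2 then 1 else 2) * F q.1.1 q.1.2 := by
  have hsub : ∑ q : {q : Fin N × Fin N // q.1 ≤ q.2},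
      (if q.1.1 = q.1.2 then 1 else 2) * F q.1.1 q.1.2 = ∑ p : Fin N × Fin N,
        if p.1 ≤ p.2 then (if p.1 = p.2 then 1 else 2) * F p.1 p.2 else 0 := by
    rw [← Finset.sum_filter, ← Finset.sum_subtype_eq_sum_filter, Finset.subtype_univ]
  have hswap : ∑ p : Fin N × Fin N, (if p.2 < p.1 then F p.1 p.2 else 0) =
      ∑ p : Fin N × Fin N, if p.1 < p.2 then F p.1 p.2 else 0 := by
    rw [← (Equiv.prodComm (Fin N) (Fin N)).sum_comp]
    exact Finset.sum_congr rfl fun p _ => by simp [hF p.2 p.1]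
  calc ∑ a, ∑ b, F a b = ∑ p : Fin N × Fin N, ((if p.1 ≤ p.2 then F p.1 p.2 else 0) +
          if p.2 < p.1 then F p.1 p.2 else 0) := by
        rw [← Fintype.sum_prod_type']
        refine Finset.sum_congr rfl fun p _ => ?_
        rcases le_or_gt p.1 p.2 with h | h
        · simp [h, h.not_gt]
        · simp [h, h.not_ge]
    _ = _ := by
        rw [Finset.sum_add_distrib, hswap, ← Finset.sum_add_distrib, hsub]
        refine Finset.sum_congr rfl fun p _ => ?_
        rcases lt_trichotomy p.1 p.2 with h | h | h
        · simp [h, h.le, h.ne, two_mul]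
        · simp [h]
        · simp [h.not_ge, h.not_gt]

/-- This makes the exponent linear in the entries of `W`, with coefficient matrix `Xᵀ * A * X`,
where `X` is the vector reshaped as an `L × N` matrix. -/
lemma dotProduct_kronecker_mulVec {L N : ℕ} (A : Matrix (Fin L) (Fin L) ℝ)
    (W : Matrix (Fin N) (Fin N) ℝ) (x : Fin L × Fin N → ℝ) :
    x ⬝ᵥ ((A ⊗ₖ W) *ᵥ x) = ∑ a, ∑ b, W a b *
      ((Matrix.of fun i a => x (i, a))ᵀ * A * (Matrix.of fun i a => x (i, a))) a b := by
  simp only [dotProduct, Matrix.mulVec, Fintype.sum_prod_type, Matrix.kroneckerMap_apply,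
    Matrix.mul_apply, Matrix.transpose_apply, Matrix.of_apply, Finset.mul_sum, Finset.sum_mul]
  rw [Finset.sum_comm]
  refine Finset.sum_congr rfl fun a _ => ?_
  rw [Finset.sum_comm]
  conv_lhs => enter [2, l]; rw [Finset.sum_comm]
  rw [Finset.sum_comm]
  exact Finset.sum_congr rfl fun b _ => Finset.sum_congr rfl fun l _ =>
    Finset.sum_congr rfl fun i _ => by ring

lemma gramMat_eq_mul_transpose {L N : ℕ} (x : Fin L × Fin N → ℝ) :
    gramMat x = (Matrix.of fun i a => x (i, a)) * (Matrix.of fun i a => x (i, a))ᵀ := by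
  ext i j
  simp [gramMat_apply, Matrix.mul_apply]

lemma transpose_gramMat {L N : ℕ} (x : Fin L × Fin N → ℝ) : (gramMat x)ᵀ = gramMat x := by
  ext i j
  simp [gramMat_apply, mul_comm]

lemma dotProduct_kronecker_one_mulVec {L N : ℕ} (A : Matrix (Fin L) (Fin L) ℝ)
    (x : Fin L × Fin N → ℝ) :
    x ⬝ᵥ ((A ⊗ₖ (1 : Matrix (Fin N) (Fin N) ℝ)) *ᵥ x) = (Aᵀ * gramMat x).trace := by
  rw [dotProduct_kronecker_mulVec, gramMat_eq_mul_transpose]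
  set X : Matrix (Fin L) (Fin N) ℝ := Matrix.of fun i a => x (i, a)
  have : ∑ a, ∑ b, (1 : Matrix (Fin N) (Fin N) ℝ) a b * (Xᵀ * A * X) a b = (Xᵀ * A * X).trace := by
    simp [Matrix.one_apply, Matrix.trace]
  rw [this, ← Matrix.trace_transpose, Matrix.transpose_mul, Matrix.transpose_mul,
    Matrix.transpose_transpose, Matrix.trace_mul_comm, Matrix.mul_assoc]

/-- The sum is the squared Frobenius norm of `Xᵀ A X`; cyclicity of the trace regroups the factors
into copies of `X Xᵀ`. It is what makes the Gaussian variance a function of the profile alone. -/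
lemma sum_sq_conj {L N : ℕ} {A : Matrix (Fin L) (Fin L) ℝ} (hA : A.IsSymm)
    (x : Fin L × Fin N → ℝ) :
    ∑ a, ∑ b, ((Matrix.of fun i a => x (i, a))ᵀ * A * (Matrix.of fun i a => x (i, a))) a b ^ 2 =
      (gramMat x * (A * gramMat x * A)).trace := by
  rw [gramMat_eq_mul_transpose]
  set X : Matrix (Fin L) (Fin N) ℝ := Matrix.of fun i a => x (i, a)
  have h1 : ∑ a, ∑ b, (Xᵀ * A * X) a b ^ 2 = ((Xᵀ * A * X) * (Xᵀ * A * X)ᵀ).trace := by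
    simp only [Matrix.trace, Matrix.diag, Matrix.mul_apply (M := Xᵀ * A * X),
      Matrix.transpose_apply (M := Xᵀ * A * X), sq]
  rw [h1, Matrix.transpose_mul, Matrix.transpose_mul, Matrix.transpose_transpose, hA.eq]
  calc _ = (Xᵀ * (A * X * (Xᵀ * (A * X)))).trace := by simp only [Matrix.mul_assoc]
    _ = _ := by 
        rw [Matrix.trace_mul_comm, Matrix.trace_mul_comm (X * Xᵀ)]; simp only [Matrix.mul_assoc]

/-- The tilting exponent as a function of the profile. -/
noncomputable def tilt {L k : ℕ} (A₀ : Matrix (Fin L) (Fin L) ℝ)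
    (A : Fin k → Matrix (Fin L) (Fin L) ℝ) (θ : ℝ) (G : Matrix (Fin L) (Fin L) ℝ) : ℝ :=
  (L : ℝ) ^ 2 * θ ^ 2 * (Gᵀ * covOp A Gᵀ).trace + L * θ * (A₀ᵀ * G).trace

lemma continuous_tilt {L k : ℕ} (A₀ : Matrix (Fin L) (Fin L) ℝ)
    (A : Fin k → Matrix (Fin L) (Fin L) ℝ) (θ : ℝ) : Continuous (tilt A₀ A θ) := by
  unfold tilt covOp
  fun_prop

/-- The expectation over the GOE matrices. -/
lemma lintegral_exp_kronModel {L N k : ℕ} (hN : 0 < N) {A₀ : Matrix (Fin L) (Fin L) ℝ}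
    {A : Fin k → Matrix (Fin L) (Fin L) ℝ} (hA : ∀ j, (A j).IsSymm)
    {Ω : Type*} [MeasurableSpace Ω] {P : Measure Ω} [IsProbabilityMeasure P]
    {W : Fin k → Ω → Matrix (Fin N) (Fin N) ℝ} (hW : IsIndepGOE P W) (θ : ℝ)
    (x : Fin L × Fin N → ℝ) :
    ∫⁻ ω, ENNReal.ofReal (Real.exp (θ * N * L *
      (x ⬝ᵥ (kronModel A₀ A (fun j => W j ω) *ᵥ x)))) ∂P =
      ENNReal.ofReal (Real.exp (N * tilt A₀ A θ (gramMat x))) := by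
  have hNpos : (0 : ℝ) < N := by exact_mod_cast hN
  set C : Fin k → Matrix (Fin N) (Fin N) ℝ := fun j =>
    (Matrix.of fun i a => x (i, a))ᵀ * A j * (Matrix.of fun i a => x (i, a)) with hC
  have hCsymm : ∀ j a b, C j a b = C j b a := fun j a b => by
    have : (C j)ᵀ = C j := by
      simp only [hC, Matrix.transpose_mul, Matrix.transpose_transpose, (hA j).eq, Matrix.mul_assoc]
    rw [← Matrix.transpose_apply (C j), this]
  set I := Fin k × {q : Fin N × Fin N // q.1 ≤ q.2}
  -- This is the coefficient of each independent entry: an off-diagonal entry occurs twice in the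
  -- symmetric sum.
  set c : I → ℝ := fun p => θ * N * L *
    ((if p.2.1.1 = p.2.1.2 then 1 else 2) * C p.1 p.2.1.1 p.2.1.2) with hc
  set d := θ * N * L * (A₀ᵀ * gramMat x).trace with hd
  have hsum : ∀ᵐ ω ∂P, ENNReal.ofReal (Real.exp (θ * N * L *
      (x ⬝ᵥ (kronModel A₀ A (fun j => W j ω) *ᵥ x)))) =
      ENNReal.ofReal (Real.exp d) *
        ∏ p : I, ENNReal.ofReal (Real.exp (c p * W p.1 ω p.2.1.1 p.2.1.2)) := by
    filter_upwards [ae_all_iff.2 hW.symm] with ω hω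
    rw [← ENNReal.ofReal_prod_of_nonneg fun _ _ => (Real.exp_pos _).le,
      ← ENNReal.ofReal_mul (Real.exp_pos _).le, ← Real.exp_sum, ← Real.exp_add]
    congr 2
    rw [kronModel, Matrix.add_mulVec, dotProduct_add, dotProduct_kronecker_one_mulVec,
      Matrix.sum_mulVec, dotProduct_sum, mul_add, ← hd, add_comm]
    congr 1
    simp_rw [dotProduct_kronecker_mulVec]
    rw [Finset.mul_sum, Fintype.sum_prod_type]
    refine Finset.sum_congr rfl fun j _ => ?_
    rw [sum_prod_eq_sum_upper (fun a b => W j ω a b * C j a b) fun a b => by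
      rw [hCsymm j a b, (hω j).apply b a], Finset.mul_sum]
    refine Finset.sum_congr rfl fun q _ => ?_
    simp only [hc]; ring
  rw [lintegral_congr_ae hsum, lintegral_const_mul' _ _ ENNReal.ofReal_ne_top,
    lintegral_prod_eq_prod_lintegral_of_indepFun Finset.univ
      (fun (p : I) ω => ENNReal.ofReal (Real.exp (c p * W p.1 ω p.2.1.1 p.2.1.2)))
      (hW.indep.comp (fun p y => ENNReal.ofReal (Real.exp (c p * y))) fun p => by fun_prop)
      (fun p => by have := hW.measurable p.1 p.2.1.1 p.2.1.2; fun_prop)]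
  simp_rw [fun p : I => lintegral_exp_mul_of_hasLaw_gaussianReal
    (hW.law p.1 p.2.1.1 p.2.1.2 p.2.2) (c p)]
  rw [← ENNReal.ofReal_prod_of_nonneg fun _ _ => (Real.exp_pos _).le,
    ← ENNReal.ofReal_mul (Real.exp_pos _).le, ← Real.exp_sum, ← Real.exp_add]
  congr 2
  -- Variance times squared coefficient, halved, is `N θ² L² C²` on the diagonal (variance `2 / N`,
  -- weight 1) and twice that off it (variance `1 / N`, weight 2). These are the weights that
  -- reassemble the full double sum of squares.
  have hquad : ∑ p : I, (((1 + if p.2.1.1 = p.2.1.2 then 1 else 0) / (N : ℝ≥0) : ℝ≥0) : ℝ) *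
      c p ^ 2 / 2 = N * ((L : ℝ) ^ 2 * θ ^ 2 * (gramMat x * covOp A (gramMat x)).trace) := by
    rw [covOp, Matrix.mul_sum, Matrix.trace_sum, Fintype.sum_prod_type, Finset.mul_sum,
      Finset.mul_sum]
    refine Finset.sum_congr rfl fun j _ => ?_
    rw [← sum_sq_conj (hA j), sum_prod_eq_sum_upper (fun a b => C j a b ^ 2) fun a b => by
      rw [hCsymm j a b], Finset.mul_sum, Finset.mul_sum]
    refine Finset.sum_congr rfl fun q _ => ?_
    simp only [hc]
    split_ifs <;> push_cast <;> field_simp <;> ring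
  rw [hquad, tilt, transpose_gramMat, hd]
  ring

/-! ### Localization of the annealed integral near `Ψ`. -/

lemma abs_apply_le_matOpNorm {L : ℕ} (B : Matrix (Fin L) (Fin L) ℝ) (i j : Fin L) :
    |B i j| ≤ matOpNorm B := by
  have h1 : B i j = (Matrix.toEuclideanCLM (n := Fin L) (𝕜 := ℝ) B
      (EuclideanSpace.single j 1)).ofLp i := by
    simp
  rw [h1, ← Real.norm_eq_abs]
  refine (PiLp.norm_apply_le _ i).trans ((ContinuousLinearMap.le_opNorm _ _).trans ?_)
  simp [matOpNorm]

lemma continuous_matOpNorm {L : ℕ} :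
    Continuous (matOpNorm : Matrix (Fin L) (Fin L) ℝ → ℝ) := by
  have h : Continuous (Matrix.toEuclideanCLM (n := Fin L) (𝕜 := ℝ)) :=
    LinearMap.continuous_of_finiteDimensional
      (Matrix.toEuclideanCLM (n := Fin L) (𝕜 := ℝ)).toAlgEquiv.toLinearMap
  exact h.norm

/-- The closed ball of radius `δ` around `Ψ` for the operator norm. -/
def nearSet {L : ℕ} (Ψ : Matrix (Fin L) (Fin L) ℝ) (δ : ℝ) : Set (Matrix (Fin L) (Fin L) ℝ) :=
  {Y | matOpNorm (Y - Ψ) ≤ δ}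

lemma continuous_matOpNorm_sub {L : ℕ} (Ψ : Matrix (Fin L) (Fin L) ℝ) :
    Continuous fun Y => matOpNorm (Y - Ψ) :=
  continuous_matOpNorm.comp (continuous_id.sub continuous_const)

lemma isClosed_nearSet {L : ℕ} (Ψ : Matrix (Fin L) (Fin L) ℝ) (δ : ℝ) :
    IsClosed (nearSet Ψ δ) :=
  isClosed_le (continuous_matOpNorm_sub Ψ) continuous_const

lemma nearSet_mem_nhds {L : ℕ} (Ψ : Matrix (Fin L) (Fin L) ℝ) {δ : ℝ} (hδ : 0 < δ) :
    nearSet Ψ δ ∈ 𝓝 Ψ :=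
  ((continuous_matOpNorm_sub Ψ).tendsto Ψ).eventually_le_const
    (by simpa [matOpNorm] using hδ)

/-- The operator norm dominates every entry, so the balls shrink to `Ψ` in the matrix topology;
properties holding near `Ψ` thus hold on a whole ball. -/
lemma eventually_nearSet_subset {L : ℕ} {Ψ : Matrix (Fin L) (Fin L) ℝ}
    {U : Set (Matrix (Fin L) (Fin L) ℝ)} (hU : U ∈ 𝓝 Ψ) : ∀ᶠ δ in 𝓝[>] 0, nearSet Ψ δ ⊆ U := by
  obtain ⟨c, hc, h⟩ := exists_entrywise_of_mem_nhds hU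
  filter_upwards [Ioo_mem_nhdsGT hc] with δ hδ Y hY
  exact h Y fun i j => ((abs_apply_le_matOpNorm (Y - Ψ) i j).trans hY).trans_lt hδ.2

section annealed

variable {L N k : ℕ} {A₀ : Matrix (Fin L) (Fin L) ℝ} {A : Fin k → Matrix (Fin L) (Fin L) ℝ}
  {Ω : Type*} [MeasurableSpace Ω] {P : Measure Ω}
  {W : Fin k → Ω → Matrix (Fin N) (Fin N) ℝ}

lemma annealed_eq_lintegral [IsProbabilityMeasure P] (hN : 0 < N) (hA : ∀ j, (A j).IsSymm) (hW : IsIndepGOE P W) (θ : ℝ)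
    (Ψ : Matrix (Fin L) (Fin L) ℝ) (δ : ℝ) :
    annealed P A₀ A W θ Ψ δ = ∫⁻ u in {u | profile u.1 ∈ nearSet Ψ δ},
      ENNReal.ofReal (Real.exp (N * tilt A₀ A θ (profile u.1))) ∂(uniformSphere L N) := by
  have hmeas : MeasurableSet {u : Metric.sphere (0 : EuclideanSpace ℝ (Fin L × Fin N)) 1 |
      profile u.1 ∈ nearSet Ψ δ} :=
    ((isClosed_nearSet Ψ δ).preimage
      (continuous_profile.comp continuous_subtype_val)).measurableSet
  rw [← lintegral_indicator hmeas, annealed]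
  refine lintegral_congr fun u => ?_
  by_cases hu : profile u.1 ∈ nearSet Ψ δ
  · have h1 : Set.indicator {v | matOpNorm (profile v - Ψ) ≤ δ} (1 : EuclideanSpace ℝ (Fin L × Fin N) → ℝ≥0∞) u.1 = 1 :=
      Set.indicator_of_mem (s := {v | matOpNorm (profile v - Ψ) ≤ δ}) hu _
    rw [h1, Set.indicator_of_mem (by exact hu)]
    simp only [mul_one]
    rw [lintegral_exp_kronModel hN hA hW, profile_eq_gramMat]
  · have h1 : Set.indicator {v | matOpNorm (profile v - Ψ) ≤ δ} (1 : EuclideanSpace ℝ (Fin L × Fin N) → ℝ≥0∞) u.1 = 0 :=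
      Set.indicator_of_notMem (s := {v | matOpNorm (profile v - Ψ) ≤ δ}) hu _
    rw [h1, Set.indicator_of_notMem (by exact hu)]
    simp

lemma annealed_le [IsProbabilityMeasure P] (hN : 0 < N) (hA : ∀ j, (A j).IsSymm) (hW : IsIndepGOE P W) {θ : ℝ}
    {Ψ : Matrix (Fin L) (Fin L) ℝ} {δ c : ℝ} (hc : ∀ Y ∈ nearSet Ψ δ, tilt A₀ A θ Y ≤ c) :
    annealed P A₀ A W θ Ψ δ ≤ ENNReal.ofReal (Real.exp (N * c)) *
      uniformSphere L N {u | profile u.1 ∈ nearSet Ψ δ} := by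
  rw [annealed_eq_lintegral hN hA hW, ← setLIntegral_const]
  refine setLIntegral_mono measurable_const fun u hu => ENNReal.ofReal_le_ofReal ?_
  have := hc _ hu
  gcongr

lemma le_annealed [IsProbabilityMeasure P] (hN : 0 < N) (hA : ∀ j, (A j).IsSymm) (hW : IsIndepGOE P W) {θ : ℝ}
    {Ψ : Matrix (Fin L) (Fin L) ℝ} {δ c : ℝ} (hc : ∀ Y ∈ nearSet Ψ δ, c ≤ tilt A₀ A θ Y) :
    ENNReal.ofReal (Real.exp (N * c)) * uniformSphere L N {u | profile u.1 ∈ nearSet Ψ δ} ≤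
      annealed P A₀ A W θ Ψ δ := by
  rw [annealed_eq_lintegral hN hA hW, ← setLIntegral_const]
  refine setLIntegral_mono' ((isClosed_nearSet Ψ δ).preimage
      (continuous_profile.comp continuous_subtype_val)).measurableSet
    fun u hu => ENNReal.ofReal_le_ofReal ?_
  have := hc _ hu
  gcongr

lemma inv_mul_log_exp (hN : 0 < N) (c : ℝ) :
    (((1 : ℝ) / N : ℝ) : EReal) * ENNReal.log (ENNReal.ofReal (Real.exp (N * c))) = c := by
  have hNpos : (0 : ℝ) < N := by exact_mod_cast hN
  rw [ENNReal.log_ofReal_of_pos (Real.exp_pos _), Real.log_exp, ← EReal.coe_mul]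
  congr 1
  field_simp

lemma logAnnealed_le (hN : 0 < N) {θ : ℝ} {Ψ : Matrix (Fin L) (Fin L) ℝ} {δ c : ℝ}
    (h : annealed P A₀ A W θ Ψ δ ≤ ENNReal.ofReal (Real.exp (N * c))) :
    logAnnealed P A₀ A W θ Ψ δ ≤ c := by
  rw [← inv_mul_log_exp hN c, logAnnealed]
  exact mul_le_mul_of_nonneg_left (ENNReal.log_le_log h) (by exact_mod_cast (by positivity))

lemma le_logAnnealed (hN : 0 < N) {θ : ℝ} {Ψ : Matrix (Fin L) (Fin L) ℝ} {δ c : ℝ}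
    (h : ENNReal.ofReal (Real.exp (N * c)) ≤ annealed P A₀ A W θ Ψ δ) :
    c ≤ logAnnealed P A₀ A W θ Ψ δ := by
  rw [← inv_mul_log_exp hN c, logAnnealed]
  exact mul_le_mul_of_nonneg_left (ENNReal.log_le_log h) (by exact_mod_cast (by positivity))

end annealed

/-! ### The rate function and its regularization. -/

lemma K_eq_coe {L k : ℕ} (A₀ : Matrix (Fin L) (Fin L) ℝ) (A : Fin k → Matrix (Fin L) (Fin L) ℝ)
    (θ : ℝ) {Ψ : Matrix (Fin L) (Fin L) ℝ} (h : 0 < Ψ.det) :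
    K A₀ A θ Ψ = ((tilt A₀ A θ Ψ + (Real.log Ψ.det / 2 + L / 2 * Real.log L) : ℝ) : EReal) := by
  rw [K, ENNReal.log_ofReal_of_pos h, ← EReal.coe_add, ← EReal.coe_mul, ← EReal.coe_add, tilt]
  congr 1
  ring

lemma K_eq_bot {L k : ℕ} (A₀ : Matrix (Fin L) (Fin L) ℝ) (A : Fin k → Matrix (Fin L) (Fin L) ℝ)
    (θ : ℝ) {Ψ : Matrix (Fin L) (Fin L) ℝ} (h : Ψ.det ≤ 0) : K A₀ A θ Ψ = ⊥ := by
  rw [K, ENNReal.ofReal_of_nonpos h, ENNReal.log_zero, EReal.bot_add,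
    EReal.coe_mul_bot_of_pos (by norm_num), EReal.add_bot]

/-- The regularized rate function stays below every level above `K`. -/
lemma eventually_regularized_lt {L k : ℕ} (hL : 0 < L) {A₀ : Matrix (Fin L) (Fin L) ℝ}
    {A : Fin k → Matrix (Fin L) (Fin L) ℝ} {θ : ℝ} {Ψ : Matrix (Fin L) (Fin L) ℝ}
    (hΨ : Ψ.PosSemidef) {c : ℝ} (hc : K A₀ A θ Ψ < c) :
    ∀ᶠ η : ℝ in 𝓝[>] 0, (tilt A₀ A θ Ψ + η) +
      (Real.log (Ψ + η • (1 : Matrix (Fin L) (Fin L) ℝ)).det / 2 +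
        L / 2 * Real.log (L + η) + η) < c := by
  have hLpos : (0 : ℝ) < L := by exact_mod_cast hL
  have hdet : Tendsto (fun η : ℝ => (Ψ + η • (1 : Matrix (Fin L) (Fin L) ℝ)).det) (𝓝 0)
      (𝓝 Ψ.det) := by
    have : Continuous fun η : ℝ => (Ψ + η • (1 : Matrix (Fin L) (Fin L) ℝ)).det := by fun_prop
    simpa using this.tendsto 0
  have hrest : Tendsto (fun η : ℝ => tilt A₀ A θ Ψ + L / 2 * Real.log (L + η) + 2 * η) (𝓝 0)
      (𝓝 (tilt A₀ A θ Ψ + L / 2 * Real.log L)) := by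
    have : ContinuousAt
        (fun η : ℝ => tilt A₀ A θ Ψ + L / 2 * Real.log (L + η) + 2 * η) 0 := by
      have hl : ContinuousAt (fun η : ℝ => Real.log (L + η)) 0 :=
        ContinuousAt.log (by fun_prop) (by simpa using hLpos.ne')
      fun_prop
    simpa using this.tendsto
  rcases hΨ.det_nonneg.eq_or_lt with h0 | hpos
  -- As `Real.log 0 = 0`, divergence to `-∞` needs the determinant to approach zero through positive
  -- values, which `η > 0` guarantees.
  · have hlog : Tendsto (fun η : ℝ => Real.log (Ψ + η • (1 : Matrix (Fin L) (Fin L) ℝ)).det)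
        (𝓝[>] 0) atBot := by
      refine Real.tendsto_log_nhdsGT_zero.comp (tendsto_nhdsWithin_iff.2 ⟨?_, ?_⟩)
      · rw [← h0] at hdet; exact hdet.mono_left nhdsWithin_le_nhds
      · filter_upwards [self_mem_nhdsWithin] with η hη
        exact (Matrix.PosDef.posSemidef_add hΨ (Matrix.PosDef.one.smul hη)).det_pos
    have := (hlog.atBot_mul_const (r := 1 / 2) (by norm_num)).atBot_add
      (hrest.mono_left nhdsWithin_le_nhds)
    filter_upwards [this.eventually_lt_atBot c] with η hη
    linarith
  · rw [K_eq_coe A₀ A θ hpos, EReal.coe_lt_coe_iff] at hc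
    have := ((hdet.log hpos.ne').mul_const (1 / 2)).add hrest
    filter_upwards [(this.mono_left nhdsWithin_le_nhds).eventually_lt_const
      (show _ < c by linarith)] with η hη
    linarith

/-- With `Q = Ψ + η • 1` one has `Q⁻¹ * Ψ = 1 - η • Q⁻¹`, and `Q⁻¹` has nonnegative trace. The bound
is uniform in `η`, so it survives for singular `Ψ`. -/
lemma trace_inv_mul_le {L : ℕ} {Ψ : Matrix (Fin L) (Fin L) ℝ} {η : ℝ} (hη : 0 < η)
    (hQ : (Ψ + η • (1 : Matrix (Fin L) (Fin L) ℝ)).PosDef) :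
    ((Ψ + η • (1 : Matrix (Fin L) (Fin L) ℝ))⁻¹ * Ψ).trace ≤ L := by
  set Q := Ψ + η • (1 : Matrix (Fin L) (Fin L) ℝ) with hQdef
  have h1 : Ψ = Q - η • (1 : Matrix (Fin L) (Fin L) ℝ) := by rw [hQdef]; abel
  have h2 := hQ.inv.posSemidef.trace_nonneg
  rw [h1, Matrix.mul_sub, Matrix.nonsing_inv_mul _ hQ.det_pos.ne'.isUnit, Matrix.trace_sub]
  simp
  positivity

/-! ### Asymptotic bounds for the annealed integral. -/

section limits

variable {L k : ℕ} {A₀ : Matrix (Fin L) (Fin L) ℝ} {A : Fin k → Matrix (Fin L) (Fin L) ℝ}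
  {Ω : ℕ → Type*} [∀ N, MeasurableSpace (Ω N)]
  {P : ∀ N, Measure (Ω N)} [∀ N, IsProbabilityMeasure (P N)]
  {W : ∀ N, Fin k → Ω N → Matrix (Fin N) (Fin N) ℝ}

/-- One `η` serves as the regularization of `Ψ`, the oscillation allowed to `tilt` and the slack in
the trace; it is fixed before `δ`, and `δ` before `N`. -/
lemma eventually_logAnnealed_le (hL : 0 < L) (hA : ∀ j, (A j).IsSymm)
    (hW : ∀ N, IsIndepGOE (P N) (W N)) {θ : ℝ} {Ψ : Matrix (Fin L) (Fin L) ℝ}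
    (hΨ : Ψ.PosSemidef) {c : ℝ} (hc : K A₀ A θ Ψ < c) :
    ∀ᶠ δ in 𝓝[>] 0, ∀ᶠ N : ℕ in atTop, logAnnealed (P N) A₀ A (W N) θ Ψ δ ≤ c := by
  obtain ⟨η, hη, hηpos : 0 < η⟩ :=
    ((eventually_regularized_lt hL hΨ hc).and self_mem_nhdsWithin).exists
  set Q := Ψ + η • (1 : Matrix (Fin L) (Fin L) ℝ) with hQdef
  have hQ : Q.PosDef := Matrix.PosDef.posSemidef_add hΨ (Matrix.PosDef.one.smul hηpos)
  have htilt : ∀ᶠ Y in 𝓝 Ψ, tilt A₀ A θ Y ≤ tilt A₀ A θ Ψ + η :=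
    ((continuous_tilt A₀ A θ).tendsto Ψ).eventually_le_const (by linarith)
  have htrace : ∀ᶠ Y in 𝓝 Ψ, (Q⁻¹ * Y).trace ≤ L + η := by
    have hcont : Continuous fun Y : Matrix (Fin L) (Fin L) ℝ => (Q⁻¹ * Y).trace := by fun_prop
    exact (hcont.tendsto Ψ).eventually_le_const
      (by have := trace_inv_mul_le hηpos hQ; linarith)
  filter_upwards [eventually_nearSet_subset (htilt.and htrace)] with δ hδ
  filter_upwards [eventually_uniformSphere_profile_le hL hQ (isClosed_nearSet Ψ δ) hηpos
    fun Y hY => (hδ hY).2, eventually_gt_atTop 0] with N hN hN0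
  refine logAnnealed_le hN0 ((annealed_le hN0 hA (hW N) fun Y hY => (hδ hY).1).trans ?_)
  refine (mul_le_mul_right hN _).trans ?_
  rw [← ENNReal.ofReal_mul (Real.exp_pos _).le, ← Real.exp_add, ← mul_add]
  refine ENNReal.ofReal_le_ofReal ?_
  gcongr

lemma eventually_le_logAnnealed (hL : 0 < L) (hA : ∀ j, (A j).IsSymm)
    (hW : ∀ N, IsIndepGOE (P N) (W N)) {θ : ℝ} {Ψ : Matrix (Fin L) (Fin L) ℝ}
    (hΨ : Ψ.PosSemidef) (hΨtr : Ψ.trace = 1) {c : ℝ} (hc : c < K A₀ A θ Ψ) :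
    ∀ᶠ δ in 𝓝[>] 0, ∀ᶠ N : ℕ in atTop, c ≤ logAnnealed (P N) A₀ A (W N) θ Ψ δ := by
  -- A singular `Ψ` has rate `⊥`, with no real level below it, so only positive definite `Ψ` remain.
  have hdet : 0 < Ψ.det := by
    by_contra h
    rw [K_eq_bot A₀ A θ (not_lt.1 h)] at hc
    exact not_lt_bot hc
  rw [K_eq_coe A₀ A θ hdet, EReal.coe_lt_coe_iff] at hc
  have hpd : Ψ.PosDef := hΨ.posDef_iff_det_ne_zero.2 hdet.ne'
  obtain ⟨ε, hε, hεc⟩ : ∃ ε > 0, c ≤ (tilt A₀ A θ Ψ - ε) +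
      (Real.log Ψ.det / 2 + L / 2 * Real.log L - ε) :=
    ⟨(tilt A₀ A θ Ψ + (Real.log Ψ.det / 2 + L / 2 * Real.log L) - c) / 2, by linarith, by linarith⟩
  have htilt : ∀ᶠ Y in 𝓝 Ψ, tilt A₀ A θ Ψ - ε ≤ tilt A₀ A θ Y :=
    ((continuous_tilt A₀ A θ).tendsto Ψ).eventually_const_le (by linarith)
  filter_upwards [eventually_nearSet_subset htilt, self_mem_nhdsWithin] with δ hδ hδpos
  filter_upwards [eventually_le_uniformSphere_profile hL hpd hΨtr (isClosed_nearSet Ψ δ)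
    (nearSet_mem_nhds Ψ hδpos) hε, eventually_gt_atTop 0] with N hN hN0
  refine le_logAnnealed hN0 (le_trans ?_ (le_annealed hN0 hA (hW N) fun Y hY => hδ hY))
  refine le_trans ?_ (mul_le_mul_right hN _)
  rw [← ENNReal.ofReal_mul (Real.exp_pos _).le, ← Real.exp_add, ← mul_add]
  refine ENNReal.ofReal_le_ofReal ?_
  gcongr

end limits

end KroneckerLDP

theorem mainTheorem6 {L k : ℕ}
    (A₀ : Matrix (Fin L) (Fin L) ℝ) (A : Fin k → Matrix (Fin L) (Fin L) ℝ)
    (hA₀ : A₀.IsSymm) (hA : ∀ j, (A j).IsSymm)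
    {Ω : ℕ → Type*} [∀ N, MeasurableSpace (Ω N)]
    (P : ∀ N, Measure (Ω N)) [∀ N, IsProbabilityMeasure (P N)]
    (W : ∀ N, Fin k → Ω N → Matrix (Fin N) (Fin N) ℝ)
    (hW : ∀ N, KroneckerLDP.IsIndepGOE (P N) (W N))
    (θ : ℝ) (Ψ : Matrix (Fin L) (Fin L) ℝ) (hΨ : Ψ.PosSemidef) (hΨtr : Ψ.trace = 1) :
    Tendsto
        (fun δ : ℝ => limsup
          (fun N : ℕ => KroneckerLDP.logAnnealed (P N) A₀ A (W N) θ Ψ δ) atTop)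
        (𝓝[>] 0) (𝓝 (KroneckerLDP.K A₀ A θ Ψ)) ∧
      Tendsto
        (fun δ : ℝ => liminf
          (fun N : ℕ => KroneckerLDP.logAnnealed (P N) A₀ A (W N) θ Ψ δ) atTop)
        (𝓝[>] 0) (𝓝 (KroneckerLDP.K A₀ A θ Ψ)) := by
  -- A matrix of size zero has trace zero, not one.
  have hL : 0 < L := by
    rcases Nat.eq_zero_or_pos L with h | h
    · subst h
      simp [Matrix.trace] at hΨtr
    · exact h
  have hlow : ∀ a < KroneckerLDP.K A₀ A θ Ψ, ∀ᶠ δ in 𝓝[>] (0 : ℝ), a < liminf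
      (fun N : ℕ => KroneckerLDP.logAnnealed (P N) A₀ A (W N) θ Ψ δ) atTop := by
    intro a ha
    -- A real level strictly between `a` and the rate makes the final inequality strict and handles
    -- infinite `a`.
    obtain ⟨c, hac, hc⟩ := EReal.lt_iff_exists_real_btwn.1 ha
    filter_upwards [KroneckerLDP.eventually_le_logAnnealed hL hA hW hΨ hΨtr hc] with δ hδ
    exact hac.trans_le (le_liminf_of_le (by isBoundedDefault) hδ)
  have hup : ∀ a > KroneckerLDP.K A₀ A θ Ψ, ∀ᶠ δ in 𝓝[>] (0 : ℝ), limsup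
      (fun N : ℕ => KroneckerLDP.logAnnealed (P N) A₀ A (W N) θ Ψ δ) atTop < a := by
    intro a ha
    obtain ⟨c, hc, hca⟩ := EReal.lt_iff_exists_real_btwn.1 ha
    filter_upwards [KroneckerLDP.eventually_logAnnealed_le hL hA hW hΨ hc] with δ hδ
    exact (limsup_le_of_le (by isBoundedDefault) hδ).trans_lt hca
  exact ⟨tendsto_order.2 ⟨fun a ha => (hlow a ha).mono fun δ h => h.trans_le (liminf_le_limsup),
      hup⟩,
    tendsto_order.2 ⟨hlow, fun a ha => (hup a ha).mono fun δ h => (liminf_le_limsup).trans_lt h⟩⟩
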